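/- Words over a finite alphabet $X$, $|X|\ge 2$, form the set $X^*$. A group $G$ with a faithful, length-preserving action on $X^*$ is a \emph{self-similar group} over $X$ if for all $g\in G$, $x\in X$ there is $g|_x\in G$ with $g(xw)=g(x)\,g|_x(w)$ for all $w\in X^*$; put $g|_{xv}=(g|_x)|_v$. It is \emph{contracting} if there is a finite set $N\subseteq G$, closed under $g\mapsto g|_x$, such that for each $g\in G$ there is $m\ge 0$ with $g|_w\in N$ for all words $w$ of length $m$. It is \emph{self-replicating} if it is transitive on the words of each length and, for each $x\in X$, the map $g\mapsto g|_x$ from the stabilizer of $x$ to $G$ is surjective. For a field $K$, the \emph{Nekrashevych algebra} $\mathcal N_K(G,X)$ is the unital $K$-$*$-algebra (with $K$-linear involution) generated by $X\cup G$ subject to: the product and identity of $G$ are those of the algebra and $g^*=g^{-1}$ for $g\in G$; $gx=g(x)\,g|_x$ for $g\in G$, $x\in X$; $y^*x=\delta_{x,y}$ for $x,y\in X$; and $\sum_{x\in X}xx^*=1$. For an integer $n>2$ let $\mathfrak G_n$ be the following group of permutations of $X^*$, where $X=\mathbb Z_n=\mathbb Z/n\mathbb Z$. Let $G=\mathbb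 Z_n^2$ (column vectors), let $H=\mathbb Z_n$ act on $X=\mathbb Z_n$ by translations, and let \[ \Phi(0)=\begin{pmatrix}1&1\\0&1\end{pmatrix},\quad \Phi(1)=\begin{pmatrix}1&0\\1&1\end{pmatrix},\quad \Phi(n-1)=\begin{pmatrix}0&1\end{pmatrix},\quad \Phi(k)=\begin{pmatrix}0&0\end{pmatrix}\ (1<k<n-1), \] regarded as automorphisms of $G$ (for $k=0,1$) and homomorphisms $G\to H$ (for the other $k$). Each $h\in H$ acts on $X^*$ by $h(xw)=(h+x)w$, and each $g\in G$ acts recursively by $g(xw)=x\,(\Phi(x)(g))(w)$. The \emph{multispinal group} $\mathfrak G_n$ is the group generated by these permutations; it is self-similar over $\mathbb Z_n$. \textbf{Theorem.} Let $n>2$ be an integer and let $K$ be a field of characteristic $p\geq 0$. Then $\mathcal N_K(\mathfrak G_n,\mathbb Z_n)$ is simple if and only if $p$ does not divide $n$. Moreover, for every finite set $\mathcal P$ of primes there is a contracting, self-replicating, self-similar group $G$ over a finite alphabet $X$ with $|X|\geq 2$ such that, for every field $K$, the algebra $\mathcal N_K(G,X)$ is simple if and only if the characteristic of $K$ does not belong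 to $\mathcal P$. -/

import Mathlib

universe u

/-! ### Self-similar groups

Words over the alphabet `X` are lists; the first letter of a word is the head of the list. -/

/-- A group `G` acting on the set of words `X*` is *self-similar* over `X` if the action is faithful
and length-preserving and if, for all `g ∈ G` and `x ∈ X`, there is an element `h = g|ₓ` of `G` with
`g(xw) = g(x) h(w)` for all words `w`. -/
class IsSelfSimilar (G X : Type*) [Group G] [MulAction G (List X)] : Prop
    extends FaithfulSMul G (List X) where
  length_smul : ∀ (g : G) (w : List X), (g • w).length = w.length
  exists_section : ∀ (g : G) (x : X), ∃ h : G, ∀ w : List X, g • (x :: w) = g • [x] ++ h • w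

section SelfSimilar

variable {G X : Type*} [Group G] [MulAction G (List X)] [IsSelfSimilar G X]

/-- The letter `g(x)`. -/
def letterAct (g : G) (x : X) : X :=
  (g • [x]).head (List.ne_nil_of_length_pos (by rw [IsSelfSimilar.length_smul]; simp))

/-- The section `g|ₓ` at a letter (it is unique because the action is faithful). -/
noncomputable def letterSection (g : G) (x : X) : G :=
  Classical.choose (IsSelfSimilar.exists_section g x)

/-- The section `g|_w` at a word, `g|_{xv} = (g|ₓ)|_v`. -/
noncomputable def wordSection (g : G) : List X → G
  | [] => g
  | x :: v => wordSection (letterSection g x) v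

end SelfSimilar

/-- `G` is *contracting* if there is a finite subset `N` of `G`, closed under taking sections, such
that for each `g ∈ G` all sections of `g` at the words of some length `n` lie in `N`. -/
def IsContracting (G X : Type*) [Group G] [MulAction G (List X)] [IsSelfSimilar G X] : Prop :=
  ∃ N : Set G, N.Finite ∧ (∀ a ∈ N, ∀ x : X, letterSection a x ∈ N) ∧
    ∀ g : G, ∃ n : ℕ, ∀ w : List X, w.length = n → wordSection g w ∈ N

/-- `G` is *self-replicating* if it is transitive on the words of each length and if, for every
letter `x`, the map `g ↦ g|ₓ` from the stabilizer of `x` to `G` is surjective. -/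
def IsSelfReplicating (G X : Type*) [Group G] [MulAction G (List X)] [IsSelfSimilar G X] : Prop :=
  (∀ u v : List X, u.length = v.length → ∃ g : G, g • u = v) ∧
    ∀ (x : X) (h : G), ∃ g : G, g • [x] = [x] ∧ letterSection g x = h

/-! ### Nekrashevych algebras -/

/-- Algebra generators of the Nekrashevych algebra: the letters `x`, their adjoints `x*`, and the
elements `g` of the group (whose adjoint `g*` is the generator `g⁻¹`). -/
inductive NekGen (G X : Type*) where
  | letter (x : X)
  | star (x : X)
  | grp (g : G)

section Nekrashevych

variable (K G X : Type*) [Field K] [Group G] [Fintype X] [MulAction G (List X)] [IsSelfSimilar G X]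

/-- The defining relations. The set of relations is stable under the involution
given by `x ↔ x*` and `g ↔ g⁻¹`, so the algebra with these relations is the `*`-algebra generated
by `X ∪ G` with the relations `g* = g⁻¹`, `g · h = gh`, `1_G = 1`, `g x = g(x) g|ₓ`,
`y* x = δ_{x,y}`, `∑ₓ x x* = 1`. -/
inductive NekRel : FreeAlgebra K (NekGen G X) → FreeAlgebra K (NekGen G X) → Prop
  | one : NekRel (FreeAlgebra.ι K (.grp 1)) 1
  | mul (g h : G) :
      NekRel (FreeAlgebra.ι K (.grp g) * FreeAlgebra.ι K (.grp h)) (FreeAlgebra.ι K (.grp (g * h)))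
  | ss (g : G) (x : X) :
      NekRel (FreeAlgebra.ι K (.grp g) * FreeAlgebra.ι K (.letter x))
        (FreeAlgebra.ι K (.letter (letterAct g x)) * FreeAlgebra.ι K (.grp (letterSection g x)))
  | ss_star (g : G) (x : X) :
      NekRel (FreeAlgebra.ι K (.star x) * FreeAlgebra.ι K (.grp g⁻¹))
        (FreeAlgebra.ι K (.grp (letterSection g x)⁻¹) * FreeAlgebra.ι K (.star (letterAct g x)))
  | ck1_same (x : X) :
      NekRel (FreeAlgebra.ι K (.star x) * FreeAlgebra.ι K (.letter x)) 1
  | ck1_ne (x y : X) (hxy : x ≠ y) :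
      NekRel (FreeAlgebra.ι K (.star y) * FreeAlgebra.ι K (.letter x)) 0
  | ck2 :
      NekRel (∑ x : X, FreeAlgebra.ι K (.letter x) * FreeAlgebra.ι K (.star x)) 1

/-- The Nekrashevych algebra of the self-similar group `G` over the alphabet `X` with coefficients
in `K`. -/
abbrev NekrashevychAlgebra : Type _ := RingQuot (NekRel K G X)

end Nekrashevych

/-! ### Automaton groups -/

/-- An invertible automaton with state set `Q`: in state `q` it reads a letter `x`, writes
`out q x`, and moves to the state `next q x`, the section of `q` at `x`. -/
structure MealyAutomaton (Q X : Type*) where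
  out : Q → Equiv.Perm X
  next : Q → X → Q

namespace MealyAutomaton

variable {Q X : Type*} (M : MealyAutomaton Q X)

/-- The map on words computed from the state `q`. -/
def run : Q → List X → List X
  | _, [] => []
  | q, x :: w => M.out q x :: run (M.next q x) w

/-- The inverse of the map computed from the state `q`. -/
def runInv : Q → List X → List X
  | _, [] => []
  | q, y :: w => (M.out q).symm y :: runInv (M.next q ((M.out q).symm y)) w

theorem runInv_run (q : Q) (w : List X) : M.runInv q (M.run q w) = w := by
  induction w generalizing q with
  | nil => rfl
  | cons x w ih => simp [run, runInv, ih]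

theorem run_runInv (q : Q) (w : List X) : M.run q (M.runInv q w) = w := by
  induction w generalizing q with
  | nil => rfl
  | cons x w ih => simp [run, runInv, ih]

/-- The permutation of `X*` given by the state `q`. -/
def statePerm (q : Q) : Equiv.Perm (List X) where
  toFun := M.run q
  invFun := M.runInv q
  left_inv := M.runInv_run q
  right_inv := M.run_runInv q

/-- The group generated by the states of the automaton. -/
def automatonGroup : Subgroup (Equiv.Perm (List X)) :=
  Subgroup.closure (Set.range M.statePerm)

theorem length_apply_of_mem {g : Equiv.Perm (List X)} (hg : g ∈ M.automatonGroup) :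
    ∀ w : List X, (g w).length = w.length := by
  have hrun : ∀ (q : Q) (w : List X), (M.run q w).length = w.length := by
    intro q w
    induction w generalizing q with
    | nil => rfl
    | cons x w ih => simp [run, ih]
  induction hg using Subgroup.closure_induction with
  | mem g hg =>
    obtain ⟨q, rfl⟩ := hg
    exact hrun q
  | one => intro w; rfl
  | mul a b _ _ ha hb => intro w; rw [Equiv.Perm.mul_apply, ha, hb]
  | inv a _ ha => intro w; rw [← ha (a⁻¹ w), Equiv.Perm.inv_def, Equiv.apply_symm_apply]

theorem exists_section_of_mem {g : Equiv.Perm (List X)} (hg : g ∈ M.automatonGroup) :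
    ∀ x : X, ∃ y : X, ∃ h ∈ M.automatonGroup, ∀ w : List X, g (x :: w) = y :: h w := by
  induction hg using Subgroup.closure_induction with
  | mem g hg =>
    obtain ⟨q, rfl⟩ := hg
    exact fun x => ⟨M.out q x, M.statePerm (M.next q x),
      Subgroup.subset_closure ⟨_, rfl⟩, fun w => rfl⟩
  | one => exact fun x => ⟨x, 1, one_mem _, fun w => rfl⟩
  | mul a b _ _ ha hb =>
    intro x
    obtain ⟨y, h, hh, hy⟩ := hb x
    obtain ⟨z, k, hk, hz⟩ := ha y
    exact ⟨z, k * h, mul_mem hk hh, fun w => by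
      rw [Equiv.Perm.mul_apply, hy, hz, Equiv.Perm.mul_apply]⟩
  | inv a ha' ha =>
    intro x
    have hl := M.length_apply_of_mem (inv_mem ha') [x]
    obtain ⟨y, hy⟩ := List.length_eq_one_iff.mp hl
    obtain ⟨z, k, hk, hz⟩ := ha y
    have hax : a [y] = [x] := by rw [← hy, Equiv.Perm.inv_def, Equiv.apply_symm_apply]
    have hzx : z = x := by
      have := (hz []).symm.trans hax
      simp_all
    refine ⟨y, k⁻¹, inv_mem hk, fun w => ?_⟩
    rw [Equiv.Perm.inv_eq_iff_eq, hz, Equiv.Perm.inv_def, Equiv.apply_symm_apply, hzx]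

instance isSelfSimilar : IsSelfSimilar M.automatonGroup X where
  length_smul g w := M.length_apply_of_mem g.2 w
  exists_section g x := by
    obtain ⟨y, h, hh, hy⟩ := M.exists_section_of_mem g.2 x
    refine ⟨⟨h, hh⟩, fun w => ?_⟩
    have h0 : h [] = [] := List.length_eq_zero_iff.mp (M.length_apply_of_mem hh [])
    change (g : Equiv.Perm (List X)) (x :: w) = (g : Equiv.Perm (List X)) [x] ++ h w
    rw [hy, hy, h0]
    rfl

end MealyAutomaton

/-! ### Multispinal groups -/

/-- The data of a multispinal group over the finite alphabet `X`: finite groups `G` and `H`, where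
`H` acts freely on `X`, and a map `Φ` from `X` to the disjoint union of `Aut(G)` and `Hom(G, H)`
with the properties (S1), (S2), (S3). In (S3) the group `A` is generated by the automorphisms among
the `Φ(x)`, the set `B` consists of the `μ ∘ α` with `α ∈ A` and `μ` a homomorphism among
the `Φ(x)`, and the kernels of the elements of `B` intersect trivially. -/
structure MultispinalData (X G H : Type*) [Finite X] [Group G] [Finite G] [Group H] [Finite H]
    [MulAction H X] where
  Φ : X → MulAut G ⊕ (G →* H)
  free : ∀ (h : H) (x : X), h • x = x → h = 1
  s1 : ∃ (x : X) (α : MulAut G), Φ x = .inl α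
  s2 : ∃ (x : X) (μ : G →* H), Φ x = .inr μ
  s3 : ∀ g : G,
    (∀ (x : X) (μ : G →* H), Φ x = .inr μ →
      ∀ α ∈ Subgroup.closure {β : MulAut G | ∃ y : X, Φ y = .inl β}, μ (α g) = 1) → g = 1

namespace MultispinalData

variable {X G H : Type*} [Finite X] [Group G] [Finite G] [Group H] [Finite H] [MulAction H X]

/-- The automaton of a multispinal group. A state `h ∈ H` acts on the first letter and has trivial
sections; a state `g ∈ G` fixes all letters and has the section `Φ(x)(g)` at `x`. The states `1_G`
and `1_H` both give the identity map of `X*`, so identifying them does not change the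
group generated by the states. -/
def automaton (D : MultispinalData X G H) : MealyAutomaton (G ⊕ H) X where
  out
    | .inl _ => 1
    | .inr h => MulAction.toPerm h
  next
    | .inl g, x => match D.Φ x with
      | .inl α => .inl (α g)
      | .inr μ => .inr (μ g)
    | .inr _, _ => .inr 1

/-- The multispinal group, generated by the states of the automaton. -/
abbrev group (D : MultispinalData X G H) : Subgroup (Equiv.Perm (List X)) :=
  D.automaton.automatonGroup

end MultispinalData

/-! ### The groups `𝔊ₙ` -/

/-- The automorphism `v ↦ M v` of the group of column vectors `(ℤ/n)²`, for `M ∈ SL₂(ℤ/n)`. -/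
def matAut {n : ℕ} (M : Matrix.SpecialLinearGroup (Fin 2) (ZMod n)) :
    MulAut (Multiplicative (Fin 2 → ZMod n)) :=
  AddEquiv.toMultiplicative (Matrix.SpecialLinearGroup.toLin' M).toAddEquiv

/-- The homomorphism `v ↦ r v` from `(ℤ/n)²` to `ℤ/n`, for a row vector `r`. -/
def rowHom {n : ℕ} (r : Fin 2 → ZMod n) :
    Multiplicative (Fin 2 → ZMod n) →* Multiplicative (ZMod n) :=
  AddMonoidHom.toMultiplicative
    { toFun := fun v => r ⬝ᵥ v
      map_zero' := dotProduct_zero r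
      map_add' := dotProduct_add r }

/-- `Φ(0) = (1 1; 0 1)`, `Φ(1) = (1 0; 1 1)`, `Φ(n-1) = (0 1)`, and `Φ(k) = (0 0)` for all other `k`
(for `n > 2`, when `0`, `1`, `n - 1` are different elements of `ℤ/n`). -/
def spinalPhi (n : ℕ) (k : ZMod n) :
    MulAut (Multiplicative (Fin 2 → ZMod n)) ⊕
      (Multiplicative (Fin 2 → ZMod n) →* Multiplicative (ZMod n)) :=
  if k = 0 then .inl (matAut ⟨!![1, 1; 0, 1], by simp [Matrix.det_fin_two]⟩)
  else if k = 1 then .inl (matAut ⟨!![1, 0; 1, 1], by simp [Matrix.det_fin_two]⟩)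
  else if k = -1 then .inr (rowHom ![0, 1])
  else .inr (rowHom ![0, 0])

instance neZero_of_fact_two_lt (n : ℕ) [h : Fact (2 < n)] : NeZero n :=
  ⟨(lt_trans Nat.zero_lt_two h.out).ne'⟩

theorem spinalPhi_neg_one (n : ℕ) [h : Fact (2 < n)] :
    spinalPhi n (-1) = .inr (rowHom ![0, 1]) := by
  have hn := h.out
  have : Fact (1 < n) := ⟨by omega⟩
  have h2 : (2 : ZMod n) ≠ 0 := by
    intro h2
    have : ((2 : ℕ) : ZMod n) = 0 := by exact_mod_cast h2
    rw [ZMod.natCast_eq_zero_iff] at this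
    exact absurd (Nat.le_of_dvd (by norm_num) this) (by omega)
  have h1 : (-1 : ZMod n) ≠ 1 := by
    intro h1
    apply h2
    calc (2 : ZMod n) = 1 - (-1) := by ring
      _ = 0 := by rw [h1]; ring
  simp [spinalPhi, h1]

/-- The multispinal data of `𝔊ₙ`, `n > 2`: `G = (ℤ/n)²`, and `H = ℤ/n` acts on `X = ℤ/n` by
translations. -/
def spinalData (n : ℕ) [Fact (2 < n)] :
    MultispinalData (ZMod n) (Multiplicative (Fin 2 → ZMod n)) (Multiplicative (ZMod n)) where
  Φ := spinalPhi n
  free h x hx := by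
    have : h.toAdd + x = x := hx
    exact Multiplicative.toAdd.injective (by simpa using this)
  s1 := ⟨0, _, by rw [spinalPhi, if_pos rfl]⟩
  s2 := ⟨-1, _, spinalPhi_neg_one n⟩
  s3 g hg := by
    have hn : 2 < n := Fact.out
    have : Fact (1 < n) := ⟨by omega⟩
    have e0 := hg (-1) _ (spinalPhi_neg_one n) 1 (one_mem _)
    have e1 := hg (-1) _ (spinalPhi_neg_one n)
      (matAut ⟨!![1, 0; 1, 1], by simp [Matrix.det_fin_two]⟩)
      (Subgroup.subset_closure ⟨1, by simp [spinalPhi]⟩)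
    have f0 : g.toAdd 1 = 0 := by
      have : (![0, 1] : Fin 2 → ZMod n) ⬝ᵥ g.toAdd = 0 := e0
      simpa [dotProduct, Fin.sum_univ_two] using this
    have f1 : g.toAdd 0 + g.toAdd 1 = 0 := by
      have : (![0, 1] : Fin 2 → ZMod n) ⬝ᵥ (Matrix.mulVec !![1, 0; 1, 1] g.toAdd) = 0 := e1
      simpa [dotProduct, Matrix.mulVec, Fin.sum_univ_two] using this
    apply Multiplicative.toAdd.injective
    funext i
    fin_cases i
    · simpa [f0] using f1
    · exact f0

/-- The multispinal group `𝔊ₙ` over the alphabet `ℤ/n`, for `n > 2`. -/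
abbrev spinalGroup (n : ℕ) [Fact (2 < n)] : Subgroup (Equiv.Perm (List (ZMod n))) :=
  (spinalData n).group

/-!
A nonzero ideal of the Nekrashevych algebra contains an element `a + q` with `a ≠ 0` in the span of
the nucleus and `q` in the span `P` of the `u g` with `u` a nonempty word. A compression
`y ↦ t* y z` by words `t`, `z` of the same length maps `P` to itself, and one with a suitable
`t = z` annihilates a given element of `P` while it fixes the scalars. So the algebra is simple as
soon as every nonzero element of the span of the nucleus has a compression that is a nonzero scalar.

For a multispinal group the nucleus spans the sum of the images of `K[G]` and `K[H]`. Compressions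
turn elements of `K[H]` into their coefficients, and elements of `K[G]` into their images in `K[H]`
under the homomorphisms `μ ∘ α` of condition (S3). For `𝔊ₙ` the group generated by `Φ(0)` and
`Φ(1)` is the image of `SL₂(ℤ)`, so every row vector is a multiple of some `(0 1) α`. Hence the
images of an element of `K[G]` determine its Fourier transform on `(ℤ/n)²`, and the element itself
if `n` is invertible in `K`.

Conversely, if `n = 0` in `K`, then `z = ∑ g` (over `g ∈ G`) acts as `0` on the functions on
infinite words, because up to an automorphism of `G` the map `g ↦ g ξ` factors through some `μ`,
and `|ker μ| = 0` in `K`. But `z ≠ 0`, since it does not annihilate the functions on germs of finite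
words: the germ of `(k, w) ↦ 0ᵏ w` as `k → ∞` has a trivial stabilizer in `G`. So the kernel of the
first representation is a proper nonzero ideal.
-/

section SelfSimilarLemmas

variable {G X : Type*} [Group G] [MulAction G (List X)] [IsSelfSimilar G X]

theorem smul_nil_word (g : G) : g • ([] : List X) = [] :=
  List.length_eq_zero_iff.mp (IsSelfSimilar.length_smul g [])

theorem smul_cons_word (g : G) (x : X) (w : List X) :
    g • (x :: w) = letterAct g x :: letterSection g x • w := by
  have h : g • [x] = [letterAct g x] := by
    obtain ⟨y, hy⟩ := List.length_eq_one_iff.mp (IsSelfSimilar.length_smul g [x])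
    simp [letterAct, hy]
  exact (Classical.choose_spec (IsSelfSimilar.exists_section g x) w).trans
    (congrArg (· ++ letterSection g x • w) h)

theorem smul_singleton_word (g : G) (x : X) : g • [x] = [letterAct g x] := by
  rw [smul_cons_word, smul_nil_word]

theorem letterAct_eq_of {g k : G} {x y : X} (h : ∀ w : List X, g • (x :: w) = y :: k • w) :
    letterAct g x = y :=
  (List.cons.inj ((smul_cons_word g x []).symm.trans (h []))).1

theorem letterSection_eq_of {g k : G} {x y : X} (h : ∀ w : List X, g • (x :: w) = y :: k • w) :
    letterSection g x = k :=
  FaithfulSMul.eq_of_smul_eq_smul (α := List X) fun w =>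
    (List.cons.inj ((smul_cons_word g x w).symm.trans (h w))).2

theorem smul_mul_cons_word (a b : G) (x : X) (w : List X) :
    (a * b) • (x :: w) = letterAct a (letterAct b x) ::
      (letterSection a (letterAct b x) * letterSection b x) • w := by
  rw [mul_smul, smul_cons_word, smul_cons_word, mul_smul]

theorem letterAct_mul (a b : G) (x : X) : letterAct (a * b) x = letterAct a (letterAct b x) :=
  letterAct_eq_of (smul_mul_cons_word a b x)

theorem letterSection_mul (a b : G) (x : X) :
    letterSection (a * b) x = letterSection a (letterAct b x) * letterSection b x :=
  letterSection_eq_of (smul_mul_cons_word a b x)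

theorem letterAct_one (x : X) : letterAct (1 : G) x = x :=
  letterAct_eq_of (k := 1) fun w => by simp

theorem letterSection_one (x : X) : letterSection (1 : G) x = 1 :=
  letterSection_eq_of (y := x) fun w => by simp

theorem letterAct_injective (g : G) : Function.Injective (letterAct g : X → X) :=
  Function.LeftInverse.injective (g := letterAct g⁻¹) fun x => by
    rw [← letterAct_mul, inv_mul_cancel, letterAct_one]

theorem wordSection_append (g : G) (u v : List X) :
    wordSection g (u ++ v) = wordSection (wordSection g u) v := by
  induction u generalizing g with
  | nil => rfl
  | cons x _ ih => exact ih _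

theorem wordSection_mul (a b : G) (w : List X) :
    wordSection (a * b) w = wordSection a (b • w) * wordSection b w := by
  induction w generalizing a b with
  | nil => rw [smul_nil_word]; rfl
  | cons x w ih => rw [smul_cons_word, wordSection, letterSection_mul, ih]; rfl

theorem smul_append_word (g : G) (u v : List X) :
    g • (u ++ v) = g • u ++ wordSection g u • v := by
  induction u generalizing g with
  | nil => rw [smul_nil_word]; rfl
  | cons x u ih => rw [List.cons_append, smul_cons_word, smul_cons_word, ih]; rfl

theorem wordSection_mem_of_letterSection_mem {N : Set G}
    (hN : ∀ {g}, g ∈ N → ∀ x : X, letterSection g x ∈ N) {g : G} (hg : g ∈ N) (w : List X) :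
    wordSection g w ∈ N := by
  induction w generalizing g with
  | nil => exact hg
  | cons x _ ih => exact ih (hN hg x)

theorem exists_smul_eq_of_length_eq (htrans : ∀ x y : X, ∃ g : G, letterAct g x = y)
    (hsec : ∀ (x : X) (h : G), ∃ g : G, letterAct g x = x ∧ letterSection g x = h) :
    ∀ u v : List X, u.length = v.length → ∃ g : G, g • u = v
  | [], [], _ => ⟨1, one_smul _ _⟩
  | x :: u, y :: v, h => by
    obtain ⟨a, ha⟩ := htrans x y
    obtain ⟨k, hk⟩ := exists_smul_eq_of_length_eq htrans hsec u v (Nat.succ.inj h)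
    obtain ⟨b, hb, hb'⟩ := hsec x ((letterSection a x)⁻¹ * k)
    exact ⟨a * b, by rw [smul_mul_cons_word, hb, ha, hb', mul_inv_cancel_left, hk]⟩

theorem isSelfReplicating_of_letterAct_transitive (htrans : ∀ x y : X, ∃ g : G, letterAct g x = y)
    (hsec : ∀ (x : X) (h : G), ∃ g : G, letterAct g x = x ∧ letterSection g x = h) :
    IsSelfReplicating G X :=
  ⟨exists_smul_eq_of_length_eq htrans hsec, fun x h =>
    let ⟨g, hg, hg'⟩ := hsec x h
    ⟨g, by rw [smul_singleton_word, hg], hg'⟩⟩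

variable (X) in
/-- A set of group elements that is closed under sections and contains all sections of every group
element at the words of some length. A self-similar group is contracting if and only if it has a
finite absorbing set. -/
structure IsAbsorbing (N : Set G) : Prop where
  letterSection_mem : ∀ {g}, g ∈ N → ∀ x : X, letterSection g x ∈ N
  exists_wordSection_mem : ∀ g : G, ∃ n, ∀ w : List X, w.length = n → wordSection g w ∈ N

namespace IsAbsorbing

variable {N : Set G} (hN : IsAbsorbing X N)
include hN

theorem isContracting (hfin : N.Finite) : IsContracting G X :=
  ⟨N, hfin, fun _ => hN.letterSection_mem, hN.exists_wordSection_mem⟩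

theorem wordSection_mem {g : G} (hg : g ∈ N) (w : List X) : wordSection g w ∈ N :=
  wordSection_mem_of_letterSection_mem hN.letterSection_mem hg w

theorem exists_forall_wordSection_mem (g : G) :
    ∃ n, ∀ w : List X, n ≤ w.length → wordSection g w ∈ N := by
  obtain ⟨n, hn⟩ := hN.exists_wordSection_mem g
  refine ⟨n, fun w hw => ?_⟩
  rw [← List.take_append_drop n w, wordSection_append]
  exact hN.wordSection_mem (hn _ (List.length_take_of_le hw)) _

end IsAbsorbing

end SelfSimilarLemmas

namespace NekrashevychAlgebra

section Basic

variable (K : Type*) {G X : Type*} [Field K] [Group G] [Fintype X] [MulAction G (List X)]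
  [IsSelfSimilar G X]

/-- The letter `x` as an element of the Nekrashevych algebra. -/
def letter (x : X) : NekrashevychAlgebra K G X :=
  RingQuot.mkAlgHom K (NekRel K G X) (FreeAlgebra.ι K (.letter x))

/-- The adjoint `x*` of the letter `x`. -/
def adj (x : X) : NekrashevychAlgebra K G X :=
  RingQuot.mkAlgHom K (NekRel K G X) (FreeAlgebra.ι K (.star x))

/-- The canonical homomorphism from the group to the Nekrashevych algebra. -/
def grp : G →* NekrashevychAlgebra K G X where
  toFun g := RingQuot.mkAlgHom K (NekRel K G X) (FreeAlgebra.ι K (.grp g))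
  map_one' := by rw [RingQuot.mkAlgHom_rel K (NekRel.one (K := K) (G := G) (X := X)), map_one]
  map_mul' g h := by rw [← RingQuot.mkAlgHom_rel K (NekRel.mul (X := X) g h), map_mul]

theorem grp_mul_letter (g : G) (x : X) :
    grp K g * letter K x = letter K (letterAct g x) * grp K (letterSection g x) := by
  have := RingQuot.mkAlgHom_rel K (NekRel.ss (K := K) g x)
  rwa [map_mul, map_mul] at this

theorem adj_mul_letter_same (x : X) : adj K x * letter K x = (1 : NekrashevychAlgebra K G X) := by
  have := RingQuot.mkAlgHom_rel K (NekRel.ck1_same (K := K) (G := G) x)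
  rwa [map_mul, map_one] at this

theorem adj_mul_letter_ne {x y : X} (h : x ≠ y) :
    adj K y * letter K x = (0 : NekrashevychAlgebra K G X) := by
  have := RingQuot.mkAlgHom_rel K (NekRel.ck1_ne (K := K) (G := G) x y h)
  rwa [map_mul, map_zero] at this

theorem sum_letter_mul_adj :
    ∑ x : X, letter K x * adj K x = (1 : NekrashevychAlgebra K G X) := by
  have := RingQuot.mkAlgHom_rel K (NekRel.ck2 (K := K) (G := G) (X := X))
  rw [map_sum, map_one] at this
  simp only [map_mul] at this
  exact this

theorem induction {p : NekrashevychAlgebra K G X → Prop}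
    (scalar : ∀ r : K, p (algebraMap K _ r)) (letter : ∀ x, p (letter K x))
    (adj : ∀ x, p (adj K x)) (grp : ∀ g, p (grp K g))
    (mul : ∀ a b, p a → p b → p (a * b)) (add : ∀ a b, p a → p b → p (a + b))
    (a : NekrashevychAlgebra K G X) : p a := by
  obtain ⟨f, rfl⟩ := RingQuot.mkAlgHom_surjective K (NekRel K G X) a
  induction f with
  | grade0 r => rw [AlgHom.commutes]; exact scalar r
  | grade1 x =>
    cases x with
    | letter x => exact letter x
    | star x => exact adj x
    | grp g => exact grp g
  | mul a b ha hb => rw [map_mul]; exact mul _ _ ha hb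
  | add a b ha hb => rw [map_add]; exact add _ _ ha hb

/-- The product in the Nekrashevych algebra of the letters of a word. -/
def word : List X → NekrashevychAlgebra K G X
  | [] => 1
  | x :: u => letter K x * word u

/-- The adjoint of `word K u`. -/
def wordAdj : List X → NekrashevychAlgebra K G X
  | [] => 1
  | x :: u => wordAdj u * adj K x

theorem word_append (u v : List X) :
    (word K (u ++ v) : NekrashevychAlgebra K G X) = word K u * word K v := by
  induction u with
  | nil => simp [word]
  | cons x u ih => rw [List.cons_append, word, ih, word, mul_assoc]

theorem wordAdj_append (u v : List X) :
    (wordAdj K (u ++ v) : NekrashevychAlgebra K G X) = wordAdj K v * wordAdj K u := by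
  induction u with
  | nil => simp [wordAdj]
  | cons x u ih => rw [List.cons_append, wordAdj, ih, wordAdj, mul_assoc]

theorem wordAdj_mul_word_self (u : List X) :
    wordAdj K u * word K u = (1 : NekrashevychAlgebra K G X) := by
  induction u with
  | nil => simp [word, wordAdj]
  | cons x u ih =>
    rw [wordAdj, word, mul_assoc, ← mul_assoc (adj K x), adj_mul_letter_same, one_mul, ih]

theorem wordAdj_mul_word_of_ne {t u : List X} (hl : t.length = u.length) (hne : t ≠ u) :
    wordAdj K t * word K u = (0 : NekrashevychAlgebra K G X) := by
  induction t generalizing u with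
  | nil => exact absurd (List.length_eq_zero_iff.mp hl.symm).symm hne
  | cons x t ih =>
    obtain _ | ⟨y, u⟩ := u
    · simp at hl
    rw [wordAdj, word, mul_assoc, ← mul_assoc (adj K x)]
    by_cases hxy : y = x
    · subst hxy
      rw [adj_mul_letter_same, one_mul, ih (by simpa using hl) (by simpa using hne)]
    · rw [adj_mul_letter_ne K hxy, zero_mul, mul_zero]

theorem grp_mul_word (g : G) (u : List X) :
    grp K g * word K u = word K (g • u) * grp K (wordSection g u) := by
  induction u generalizing g with
  | nil => simp [word, wordSection, smul_nil_word]
  | cons x u ih =>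
    rw [word, ← mul_assoc, grp_mul_letter, mul_assoc, ih, smul_cons_word, word, mul_assoc,
      wordSection]

theorem exists_adj_mul_ne_zero {f : NekrashevychAlgebra K G X} (hf : f ≠ 0) :
    ∃ x : X, adj K x * f ≠ 0 := by
  by_contra! h
  refine hf ?_
  rw [← one_mul f, ← sum_letter_mul_adj, Finset.sum_mul]
  exact Finset.sum_eq_zero fun x _ => by rw [mul_assoc, h, mul_zero]

theorem exists_mul_letter_ne_zero {f : NekrashevychAlgebra K G X} (hf : f ≠ 0) :
    ∃ x : X, f * letter K x ≠ 0 := by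
  by_contra! h
  refine hf ?_
  rw [← mul_one f, ← sum_letter_mul_adj, Finset.mul_sum]
  exact Finset.sum_eq_zero fun x _ => by rw [← mul_assoc, h, zero_mul]

theorem exists_mul_word_ne_zero {f : NekrashevychAlgebra K G X} (hf : f ≠ 0) (m : ℕ) :
    ∃ v : List X, v.length = m ∧ f * word K v ≠ 0 := by
  induction m generalizing f with
  | zero => exact ⟨[], rfl, by rwa [word, mul_one]⟩
  | succ m ih =>
    obtain ⟨x, hx⟩ := exists_mul_letter_ne_zero K hf
    obtain ⟨v, hv, hfv⟩ := ih hx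
    exact ⟨x :: v, by rw [List.length_cons, hv], by rwa [word, ← mul_assoc]⟩

end Basic

section Representation

variable (K : Type*) {G X S : Type*} [Field K] [Group G] [MulAction G S]

open Classical in
/-- The operators on the functions `S → K` by which the algebra generators act, given a bijection
`c : X × S ≃ S`. The operator of a letter `x` transports functions along the injection
`s ↦ c (x, s)` and extends them by zero. -/
noncomputable def genOp (c : X × S ≃ S) : NekGen G X → Module.End K (S → K)
  | .letter x =>
    { toFun := fun f s => if (c.symm s).1 = x then f (c.symm s).2 else 0
      map_add' := fun f f' => by ext s; simp only [Pi.add_apply]; split_ifs <;> simp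
      map_smul' := fun r f => by ext s; simp }
  | .star x => LinearMap.funLeft K K fun s => c (x, s)
  | .grp g => LinearMap.funLeft K K fun s => g⁻¹ • s

open Classical in
theorem genOp_letter_apply (c : X × S ≃ S) (x y : X) (f : S → K) (s : S) :
    genOp (G := G) K c (.letter x) f (c (y, s)) = if y = x then f s else 0 := by
  simp [genOp]

theorem genOp_star_apply (c : X × S ≃ S) (x : X) (f : S → K) (s : S) :
    genOp (G := G) K c (.star x) f s = f (c (x, s)) :=
  rfl

theorem genOp_grp_apply (c : X × S ≃ S) (g : G) (f : S → K) (s : S) :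
    genOp K c (.grp g) f s = f (g⁻¹ • s) :=
  rfl

variable [Fintype X] [MulAction G (List X)] [IsSelfSimilar G X]
  (c : X × S ≃ S) (hc : ∀ (g : G) (x : X) (s : S),
    g • c (x, s) = c (letterAct g x, letterSection g x • s))

include hc in
theorem genOp_lift_eq_of_nekRel {a b : FreeAlgebra K (NekGen G X)} (hab : NekRel K G X a b) :
    FreeAlgebra.lift K (genOp K c) a = FreeAlgebra.lift K (genOp K c) b := by
  classical
  ext f s
  cases hab with
  | one => simp [genOp_grp_apply]
  | mul g h => simp [genOp_grp_apply, mul_smul]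
  | ss g x =>
    obtain ⟨⟨y, t⟩, rfl⟩ := (c.trans (MulAction.toPerm g)).surjective s
    simp only [Equiv.trans_apply, MulAction.toPerm_apply, map_mul, FreeAlgebra.lift_ι_apply,
      Module.End.mul_apply, genOp_grp_apply, inv_smul_smul, genOp_letter_apply]
    rw [hc, genOp_letter_apply, genOp_grp_apply]
    simp only [(letterAct_injective g).eq_iff]
    split_ifs with hyx
    · rw [hyx, inv_smul_smul]
    · rfl
  | ss_star g x => simp [genOp_grp_apply, genOp_star_apply, hc]
  | ck1_same x => simp [genOp_star_apply, genOp_letter_apply]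
  | ck1_ne x y hxy => simp [genOp_star_apply, genOp_letter_apply, hxy.symm]
  | ck2 =>
    obtain ⟨⟨y, t⟩, rfl⟩ := c.surjective s
    simp [genOp_star_apply, genOp_letter_apply]

/-- The representation of the Nekrashevych algebra on the functions `S → K`, for a `G`-set `S` with
a bijection `X × S ≃ S` that is compatible with the self-similarity of `G`. -/
noncomputable def rep : NekrashevychAlgebra K G X →ₐ[K] Module.End K (S → K) :=
  RingQuot.liftAlgHom K ⟨FreeAlgebra.lift K (genOp K c), fun _ _ => genOp_lift_eq_of_nekRel K c hc⟩

theorem rep_grp_apply (g : G) (f : S → K) (s : S) : rep K c hc (grp K g) f s = f (g⁻¹ • s) := by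
  have : rep K c hc (grp K g) = genOp K c (.grp g) :=
    (RingQuot.liftAlgHom_mkAlgHom_apply K _ _ _).trans (FreeAlgebra.lift_ι_apply _ _)
  rw [this, genOp_grp_apply]

end Representation

end NekrashevychAlgebra

section Streams

variable {G X : Type*} [Group G] [MulAction G (List X)] [IsSelfSimilar G X]

/-- The action of a self-similar group on the infinite words, extending its action on the finite
ones. -/
noncomputable instance streamSMul : SMul G (Stream' X) where
  smul g ξ := Stream'.corec'
    (fun p : G × Stream' X => (letterAct p.1 p.2.head, letterSection p.1 p.2.head, p.2.tail)) (g, ξ)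

theorem smul_cons_stream (g : G) (x : X) (ξ : Stream' X) :
    g • Stream'.cons x ξ = Stream'.cons (letterAct g x) (letterSection g x • ξ) :=
  Stream'.corec'_eq _ _

theorem one_smul_stream_get (n : ℕ) (ξ : Stream' X) : ((1 : G) • ξ).get n = ξ.get n := by
  induction n generalizing ξ with
  | zero => rw [← ξ.eta, smul_cons_stream, letterAct_one]; rfl
  | succ n ih =>
    rw [← ξ.eta, smul_cons_stream, letterSection_one, Stream'.get_succ_cons, ih,
      Stream'.get_succ_cons]

theorem mul_smul_stream_get (n : ℕ) (g h : G) (ξ : Stream' X) :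
    ((g * h) • ξ).get n = (g • h • ξ).get n := by
  induction n generalizing g h ξ with
  | zero => rw [← ξ.eta, smul_cons_stream, smul_cons_stream, smul_cons_stream, letterAct_mul]; rfl
  | succ n ih =>
    rw [← ξ.eta, smul_cons_stream, smul_cons_stream, smul_cons_stream, letterSection_mul,
      Stream'.get_succ_cons, ih, Stream'.get_succ_cons]

noncomputable instance streamMulAction : MulAction G (Stream' X) where
  one_smul ξ := Stream'.ext fun n => one_smul_stream_get n ξ
  mul_smul g h ξ := Stream'.ext fun n => mul_smul_stream_get n g h ξ

variable (X) in
/-- The bijection from pairs of a letter and an infinite word to infinite words that prepends the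
letter. -/
def consStreamEquiv : X × Stream' X ≃ Stream' X where
  toFun p := Stream'.cons p.1 p.2
  invFun ξ := (ξ.head, ξ.tail)
  left_inv _ := rfl
  right_inv ξ := ξ.eta

end Streams

section RegularGerms

open Filter

variable {Ω G X : Type*} [Group G] [MulAction G (List X)] [IsSelfSimilar G X] {l : Filter Ω}

variable (G X l) in
/-- The germs along `l` of the word-valued functions whose prefixes of each length are eventually
constant. Like infinite words, they admit unique first letters, but in general a regular germ is not
determined by its letters, and the action of `G` on regular germs has smaller stabilizers. -/
def regularGerms : SubMulAction G (Germ l (List X)) where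
  carrier := {φ | ∀ n : ℕ, ∃ u : List X, u.length = n ∧ φ.LiftPred (u <+: ·)}
  smul_mem' g φ hφ n := by
    obtain ⟨u, hu, h⟩ := hφ n
    refine ⟨g • u, by rw [IsSelfSimilar.length_smul, hu], ?_⟩
    induction φ using Germ.inductionOn with
    | h f =>
      refine Eventually.mono (Germ.liftPred_coe.mp h) fun ω ⟨r, hr⟩ => ⟨wordSection g u • r, ?_⟩
      change _ = g • f ω
      rw [← hr, smul_append_word]

theorem coe_mem_regularGerms {f : Ω → List X} :
    (f : Germ l (List X)) ∈ regularGerms G X l ↔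
      ∀ n : ℕ, ∃ u : List X, u.length = n ∧ ∀ᶠ ω in l, u <+: f ω :=
  Iff.rfl

theorem map_cons_mem_regularGerms {φ : Germ l (List X)} (hφ : φ ∈ regularGerms G X l) (x : X) :
    φ.map (List.cons x) ∈ regularGerms G X l := by
  induction φ using Germ.inductionOn with
  | h f =>
    refine coe_mem_regularGerms.mpr fun n => ?_
    obtain _ | n := n
    · exact ⟨[], rfl, .of_forall fun _ => List.nil_prefix⟩
    · obtain ⟨u, hu, h⟩ := coe_mem_regularGerms.mp hφ n
      exact ⟨x :: u, by simp [hu], h.mono fun ω hω => List.cons_prefix_cons.mpr ⟨rfl, hω⟩⟩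

theorem exists_map_cons_eq {φ : Germ l (List X)} (hφ : φ ∈ regularGerms G X l) :
    ∃ x, ∃ ψ ∈ regularGerms G X l, ψ.map (List.cons x) = φ := by
  induction φ using Germ.inductionOn with
  | h f =>
    obtain ⟨u, hu, h⟩ := coe_mem_regularGerms.mp hφ 1
    obtain ⟨x, rfl⟩ := List.length_eq_one_iff.mp hu
    have hx : ∀ᶠ ω in l, x :: (f ω).drop 1 = f ω := h.mono fun ω ⟨v, hv⟩ => by rw [← hv]; rfl
    refine ⟨x, ((fun ω => (f ω).drop 1 : Ω → List X) : Germ l (List X)), fun n => ?_,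
      Germ.coe_eq.mpr hx⟩
    obtain ⟨v, hv, h'⟩ := coe_mem_regularGerms.mp hφ (n + 1)
    exact ⟨v.drop 1, by simp [hv], h'.mono fun ω hω => List.IsPrefix.drop hω 1⟩

theorem injective2_map_cons [l.NeBot] :
    Function.Injective2 fun (x : X) (φ : Germ l (List X)) => φ.map (List.cons x) := by
  intro x y φ ψ h
  induction φ, ψ using Germ.inductionOn₂ with
  | h f f' =>
    have h : ∀ᶠ ω in l, x :: f ω = y :: f' ω := Germ.coe_eq.mp h
    obtain ⟨ω, hω⟩ := h.exists
    exact ⟨(List.cons.inj hω).1, Germ.coe_eq.mpr (h.mono fun ω hω => (List.cons.inj hω).2)⟩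

variable (G X l) in
/-- The bijection from pairs of a letter and a regular germ to regular germs that prepends the
letter. -/
noncomputable def consGermEquiv [l.NeBot] : X × regularGerms G X l ≃ regularGerms G X l :=
  Equiv.ofBijective (fun p => ⟨p.2.1.map (List.cons p.1), map_cons_mem_regularGerms p.2.2 p.1⟩)
    ⟨fun p q h => by
      obtain ⟨h₁, h₂⟩ := injective2_map_cons (congrArg Subtype.val h)
      exact Prod.ext h₁ (Subtype.ext h₂),
    fun φ => by
      obtain ⟨x, ψ, hψ, h⟩ := exists_map_cons_eq φ.2
      exact ⟨(x, ⟨ψ, hψ⟩), Subtype.ext h⟩⟩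

theorem smul_consGermEquiv [l.NeBot] (g : G) (x : X) (φ : regularGerms G X l) :
    g • consGermEquiv G X l (x, φ) =
      consGermEquiv G X l (letterAct g x, letterSection g x • φ) := by
  obtain ⟨φ, hφ⟩ := φ
  apply Subtype.ext
  induction φ using Germ.inductionOn with
  | h f => exact Germ.coe_eq.mpr (.of_forall fun ω => smul_cons_word g x (f ω))

end RegularGerms

namespace NekrashevychAlgebra

variable (K : Type*) {G X : Type*} [Field K] [Group G] [Fintype X] [MulAction G (List X)]
  [IsSelfSimilar G X]

variable (G X) in
/-- The representation of the Nekrashevych algebra on the functions on infinite words. -/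
noncomputable def streamRep : NekrashevychAlgebra K G X →ₐ[K] Module.End K (Stream' X → K) :=
  rep K (consStreamEquiv X) smul_cons_stream

theorem streamRep_grp_apply (g : G) (f : Stream' X → K) (ξ : Stream' X) :
    streamRep K G X (grp K g) f ξ = f (g⁻¹ • ξ) :=
  rep_grp_apply K _ _ g f ξ

variable (G X) in
/-- The representation of the Nekrashevych algebra on the functions on regular germs. -/
noncomputable def germRep {Ω : Type*} (l : Filter Ω) [l.NeBot] :
    NekrashevychAlgebra K G X →ₐ[K] Module.End K (regularGerms G X l → K) :=
  rep K (consGermEquiv G X l) smul_consGermEquiv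

theorem germRep_grp_apply {Ω : Type*} (l : Filter Ω) [l.NeBot] (g : G)
    (f : regularGerms G X l → K) (φ : regularGerms G X l) :
    germRep K G X l (grp K g) f φ = f (g⁻¹ • φ) :=
  rep_grp_apply K _ _ g f φ

instance [Nonempty X] : Nontrivial (NekrashevychAlgebra K G X) := by
  have : Nonempty (Stream' X) := ⟨Stream'.const (Classical.arbitrary X)⟩
  exact (streamRep K G X).toRingHom.domain_nontrivial

end NekrashevychAlgebra

namespace NekrashevychAlgebra

variable (K : Type*) {G X : Type*} [Field K] [Group G] [Fintype X] [MulAction G (List X)]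
  [IsSelfSimilar G X]

section Compress

/-- The compression `y ↦ t* y z` by words `t` and `z`. Compressions preserve two-sided ideals. -/
def compress (t z : List X) : NekrashevychAlgebra K G X →ₗ[K] NekrashevychAlgebra K G X :=
  LinearMap.mulLeftRight K (wordAdj K t, word K z)

theorem compress_apply (t z : List X) (y : NekrashevychAlgebra K G X) :
    compress K t z y = wordAdj K t * y * word K z :=
  rfl

theorem compress_append (t t' z z' : List X) (y : NekrashevychAlgebra K G X) :
    compress K (t ++ t') (z ++ z') y = compress K t' z' (compress K t z y) := by
  simp only [compress_apply, word_append, wordAdj_append, mul_assoc]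

theorem compress_mem {I : TwoSidedIdeal (NekrashevychAlgebra K G X)}
    {y : NekrashevychAlgebra K G X} (hy : y ∈ I) (t z : List X) : compress K t z y ∈ I :=
  I.mul_mem_right _ _ (I.mul_mem_left _ _ hy)

theorem compress_self_algebraMap (t : List X) (r : K) :
    compress K t t (algebraMap K (NekrashevychAlgebra K G X) r) = algebraMap K _ r := by
  rw [compress_apply, ← Algebra.commutes, mul_assoc, wordAdj_mul_word_self, mul_one]

theorem compress_grp_of_smul_eq {g : G} {t z : List X} (h : g • z = t) :
    compress K t z (grp K g) = grp K (wordSection g z) := by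
  rw [compress_apply, mul_assoc, grp_mul_word, h, ← mul_assoc, wordAdj_mul_word_self, one_mul]

theorem compress_grp_of_smul_ne {g : G} {t z : List X} (hl : t.length = z.length)
    (h : g • z ≠ t) : compress K t z (grp K g) = 0 := by
  rw [compress_apply, mul_assoc, grp_mul_word, ← mul_assoc,
    wordAdj_mul_word_of_ne K (by rw [hl, IsSelfSimilar.length_smul]) h.symm, zero_mul]

theorem compress_word_mul_grp {t z : List X} (hl : t.length = z.length) (s : List X) (g : G) :
    compress K t z (word K s * grp K g) = 0 ∨ ∃ s' g', s'.length = s.length ∧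
      compress K t z (word K s * grp K g) = word K s' * grp K g' := by
  set r := s ++ g • z with hr
  have hlen : r.length = s.length + t.length := by simp [r, IsSelfSimilar.length_smul, hl]
  have hcompress : compress K t z (word K s * grp K g) =
      wordAdj K t * word K (r.take t.length) *
        (word K (r.drop t.length) * grp K (wordSection g z)) := by
    rw [mul_assoc, ← mul_assoc (word K _) (word K _), ← word_append, List.take_append_drop, hr,
      word_append, mul_assoc, ← grp_mul_word, compress_apply]
    simp only [mul_assoc]
  have hlt : t.length = (r.take t.length).length := by simp [hlen]
  by_cases h : t = r.take t.length
  · refine .inr ⟨r.drop t.length, wordSection g z, by simp [hlen], ?_⟩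
    rw [hcompress, ← h, wordAdj_mul_word_self, one_mul]
  · exact .inl (by rw [hcompress, wordAdj_mul_word_of_ne K hlt h, zero_mul])

end Compress

section WordSpan

/-- The span of the elements `u g` of the Nekrashevych algebra with `u ∈ U` and `g ∈ N`. -/
def wordSpan (U : Set (List X)) (N : Set G) : Submodule K (NekrashevychAlgebra K G X) :=
  Submodule.span K (Set.image2 (fun u g => word K u * grp K g) U N)

variable {K} {U U' : Set (List X)} {N N' : Set G}

theorem word_mul_grp_mem_wordSpan {u : List X} {g : G} (hu : u ∈ U) (hg : g ∈ N) :
    word K u * grp K g ∈ wordSpan K U N :=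
  Submodule.subset_span (Set.mem_image2_of_mem hu hg)

theorem map_mem_of_mem_wordSpan {M : Type*} [AddCommGroup M] [Module K M] {V : Submodule K M}
    (φ : NekrashevychAlgebra K G X →ₗ[K] M)
    (hφ : ∀ u ∈ U, ∀ g ∈ N, φ (word K u * grp K g) ∈ V)
    {y : NekrashevychAlgebra K G X} (hy : y ∈ wordSpan K U N) : φ y ∈ V := by
  have : wordSpan K U N ≤ V.comap φ := Submodule.span_le.mpr (Set.image2_subset_iff.mpr hφ)
  exact this hy

theorem wordSpan_mono (hU : U ⊆ U') (hN : N ⊆ N') : wordSpan K U N ≤ wordSpan K U' N' :=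
  Submodule.span_mono (Set.image2_subset hU hN)

theorem wordSpan_union : wordSpan K (U ∪ U') N = wordSpan K U N ⊔ wordSpan K U' N := by
  rw [wordSpan, Set.image2_union_left, Submodule.span_union, wordSpan, wordSpan]

theorem wordSpan_singleton_nil :
    wordSpan K {([] : List X)} N = Submodule.span K (grp K '' N) := by
  rw [wordSpan, Set.image2_singleton_left]
  simp only [word, one_mul]

theorem mul_grp_mem_wordSpan_univ {y : NekrashevychAlgebra K G X}
    (hy : y ∈ wordSpan K U Set.univ) (g : G) : y * grp K g ∈ wordSpan K U Set.univ :=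
  map_mem_of_mem_wordSpan (LinearMap.mulRight K (grp K g)) (fun u hu h _ => by
    rw [LinearMap.mulRight_apply, mul_assoc, ← map_mul]
    exact word_mul_grp_mem_wordSpan hu (Set.mem_univ _)) hy

variable (K G) in
theorem word_mem_wordSpan_univ (u : List X) :
    word K u ∈ wordSpan K Set.univ (Set.univ : Set G) := by
  simpa using word_mul_grp_mem_wordSpan (K := K) (Set.mem_univ u) (Set.mem_univ (1 : G))

theorem mul_mul_word_mem_wordSpan_univ {a b : NekrashevychAlgebra K G X} {m : ℕ}
    (ha : ∀ w : List X, m ≤ w.length → a * word K w ∈ wordSpan K Set.univ Set.univ) {v w : List X}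
    (hb : b * word K v ∈ wordSpan K Set.univ Set.univ) (hw : m ≤ w.length) :
    a * b * word K (v ++ w) ∈ wordSpan K Set.univ Set.univ := by
  have hbw : a * (b * word K v) * word K w ∈ wordSpan K Set.univ Set.univ :=
    map_mem_of_mem_wordSpan (LinearMap.mulLeftRight K (a, word K w)) (fun u _ g _ => ?_) hb
  · simpa only [word_append, mul_assoc] using hbw
  · have hau : a * word K (u ++ g • w) ∈ wordSpan K Set.univ Set.univ :=
      ha _ (by rw [List.length_append, IsSelfSimilar.length_smul]; lia)
    simpa only [LinearMap.mulLeftRight_apply, mul_assoc, word_append, grp_mul_word] using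
      mul_grp_mem_wordSpan_univ hau (wordSection g w)

variable (K) in
theorem exists_mul_word_mem_wordSpan_univ (f : NekrashevychAlgebra K G X) :
    ∃ m, ∀ w : List X, m ≤ w.length → f * word K w ∈ wordSpan K Set.univ (Set.univ : Set G) := by
  induction f using NekrashevychAlgebra.induction with
  | scalar r =>
    refine ⟨0, fun w _ => ?_⟩
    rw [← Algebra.smul_def]
    exact Submodule.smul_mem _ _ (word_mem_wordSpan_univ K G w)
  | letter x => exact ⟨0, fun w _ => word_mem_wordSpan_univ K G (x :: w)⟩
  | adj x =>
    refine ⟨1, fun w hw => ?_⟩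
    obtain _ | ⟨y, w⟩ := w
    · simp at hw
    by_cases hyx : y = x
    · rw [hyx, word, ← mul_assoc, adj_mul_letter_same, one_mul]
      exact word_mem_wordSpan_univ K G w
    · rw [word, ← mul_assoc, adj_mul_letter_ne K hyx, zero_mul]
      exact zero_mem _
  | grp g =>
    refine ⟨0, fun w _ => ?_⟩
    rw [grp_mul_word]
    exact word_mul_grp_mem_wordSpan (Set.mem_univ _) (Set.mem_univ _)
  | mul a b ha hb =>
    obtain ⟨m, hm⟩ := ha
    obtain ⟨n, hn⟩ := hb
    refine ⟨n + m, fun w hw => ?_⟩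
    rw [← List.take_append_drop n w]
    refine mul_mul_word_mem_wordSpan_univ hm (hn _ (List.length_take_of_le (by lia)).ge) ?_
    rw [List.length_drop]
    lia
  | add a b ha hb =>
    obtain ⟨m, hm⟩ := ha
    obtain ⟨n, hn⟩ := hb
    refine ⟨max m n, fun w hw => ?_⟩
    rw [add_mul]
    exact add_mem (hm w (le_of_max_le_left hw)) (hn w (le_of_max_le_right hw))

theorem exists_length_le_of_mem_wordSpan {y : NekrashevychAlgebra K G X}
    (hy : y ∈ wordSpan K Set.univ N) : ∃ L, y ∈ wordSpan K {u | u.length ≤ L} N := by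
  induction hy using Submodule.span_induction with
  | mem y hy =>
    obtain ⟨u, -, g, hg, rfl⟩ := hy
    exact ⟨u.length, word_mul_grp_mem_wordSpan (le_refl u.length) hg⟩
  | zero => exact ⟨0, zero_mem _⟩
  | add y z _ _ hy hz =>
    obtain ⟨L, hL⟩ := hy
    obtain ⟨M, hM⟩ := hz
    have hmono {L' : ℕ} (h : L' ≤ max L M) :
        {u : List X | u.length ≤ L'} ⊆ {u | u.length ≤ max L M} := fun _ hu => hu.trans h
    exact ⟨max L M, add_mem (wordSpan_mono (hmono (le_max_left L M)) subset_rfl hL)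
      (wordSpan_mono (hmono (le_max_right L M)) subset_rfl hM)⟩
  | smul r y _ hy =>
    obtain ⟨L, hL⟩ := hy
    exact ⟨L, Submodule.smul_mem _ r hL⟩

theorem adj_mul_mem_wordSpan_length_le {L : ℕ} {q : NekrashevychAlgebra K G X}
    (hq : q ∈ wordSpan K {u | u ≠ [] ∧ u.length ≤ L + 1} N) (x : X) :
    adj K x * q ∈ wordSpan K {u | u.length ≤ L} N := by
  refine map_mem_of_mem_wordSpan (LinearMap.mulLeft K (adj K x)) (fun u hu g hg => ?_) hq
  obtain _ | ⟨y, u⟩ := u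
  · exact absurd rfl hu.1
  rw [LinearMap.mulLeft_apply, word, ← mul_assoc, ← mul_assoc]
  by_cases hyx : y = x
  · rw [hyx, adj_mul_letter_same, one_mul]
    exact word_mul_grp_mem_wordSpan (Nat.le_of_succ_le_succ hu.2) hg
  · rw [adj_mul_letter_ne K hyx, zero_mul, zero_mul]
    exact zero_mem _

end WordSpan

section PositivePart

variable (G X) in
/-- The span of the elements `u g` of the Nekrashevych algebra with `u` a nonempty word. -/
def positivePart : Submodule K (NekrashevychAlgebra K G X) :=
  wordSpan K {u | u ≠ []} Set.univ

variable {K}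

theorem compress_mem_positivePart {q : NekrashevychAlgebra K G X} (hq : q ∈ positivePart K G X)
    {t z : List X} (hl : t.length = z.length) : compress K t z q ∈ positivePart K G X := by
  refine map_mem_of_mem_wordSpan (compress K t z) (fun s hs g _ => ?_) hq
  obtain h | ⟨s', g', hs', h⟩ := compress_word_mul_grp K hl s g
  · rw [h]
    exact zero_mem _
  · rw [h]
    refine word_mul_grp_mem_wordSpan (fun h0 => hs ?_) (Set.mem_univ _)
    rw [← List.length_eq_zero_iff, ← hs', h0, List.length_nil]

theorem exists_compress_word_mul_grp_eq_zero [Nontrivial X] {s : List X} (hs : s ≠ []) (g : G)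
    (t : List X) : ∃ t', compress K (t ++ t') (t ++ t') (word K s * grp K g) = 0 := by
  obtain h | ⟨s', g', hs', h⟩ := compress_word_mul_grp K (rfl : t.length = t.length) s g
  · exact ⟨[], by simpa using h⟩
  · obtain _ | ⟨x, r⟩ := s'
    · exact absurd (List.length_eq_zero_iff.mp hs'.symm) hs
    obtain ⟨y, hy⟩ := exists_ne x
    refine ⟨y :: r, ?_⟩
    rw [compress_append, h, compress_apply, ← mul_assoc,
      wordAdj_mul_word_of_ne K (by simp) (by simpa using hy), zero_mul, zero_mul]

theorem exists_compress_eq_zero [Nontrivial X] {q : NekrashevychAlgebra K G X}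
    (hq : q ∈ positivePart K G X) (t : List X) :
    ∃ t' : List X, compress K (t ++ t') (t ++ t') q = 0 := by
  induction hq using Submodule.span_induction generalizing t with
  | mem q hq =>
    obtain ⟨s, hs, g, -, rfl⟩ := hq
    exact exists_compress_word_mul_grp_eq_zero hs g t
  | zero => exact ⟨[], map_zero _⟩
  | add a b _ _ ha hb =>
    obtain ⟨t₁, h₁⟩ := ha t
    obtain ⟨t₂, h₂⟩ := hb (t ++ t₁)
    refine ⟨t₁ ++ t₂, ?_⟩
    rw [← List.append_assoc, map_add, h₂, compress_append, h₁, map_zero, add_zero]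
  | smul r a _ ha =>
    obtain ⟨t', h⟩ := ha t
    exact ⟨t', by rw [map_smul, h, smul_zero]⟩

theorem one_mem_of_algebraMap_add_mem [Nontrivial X]
    {I : TwoSidedIdeal (NekrashevychAlgebra K G X)} {r : K} (hr : r ≠ 0)
    {q : NekrashevychAlgebra K G X} (hq : q ∈ positivePart K G X)
    (hI : algebraMap K _ r + q ∈ I) : 1 ∈ I := by
  obtain ⟨t, ht⟩ := exists_compress_eq_zero hq []
  have hrI := compress_mem K hI t t
  rw [map_add, compress_self_algebraMap, ← List.nil_append t, ht, add_zero] at hrI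
  simpa [← map_mul, inv_mul_cancel₀ hr] using I.mul_mem_left (algebraMap K _ r⁻¹) _ hrI

/-- Since `∑ₓ x x* = 1`, letters can be removed from the left of `y`, one at a time, without getting
`0`, until a nonzero component of degree `0` appears. -/
theorem exists_wordAdj_mul_eq_add {N : Set G} {L : ℕ} {y : NekrashevychAlgebra K G X} (hy0 : y ≠ 0)
    (hy : y ∈ wordSpan K {u | u.length ≤ L} N) :
    ∃ t, ∃ a ∈ Submodule.span K (grp K '' N), a ≠ 0 ∧ ∃ q ∈ positivePart K G X,
      wordAdj K t * y = a + q := by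
  induction L generalizing y with
  | zero =>
    have hnil : {u : List X | u.length ≤ 0} = {[]} := by ext; simp
    rw [hnil, wordSpan_singleton_nil] at hy
    exact ⟨[], y, hy, hy0, 0, zero_mem _, by rw [wordAdj, one_mul, add_zero]⟩
  | succ L ih =>
    have hsplit : {u : List X | u.length ≤ L + 1} = {[]} ∪ {u | u ≠ [] ∧ u.length ≤ L + 1} := by
      ext u; cases u <;> simp
    rw [hsplit, wordSpan_union, wordSpan_singleton_nil, Submodule.mem_sup] at hy
    obtain ⟨a, ha, q, hq, rfl⟩ := hy
    by_cases ha0 : a = 0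
    · rw [ha0, zero_add] at hy0 ⊢
      obtain ⟨x, hx⟩ := exists_adj_mul_ne_zero K hy0
      obtain ⟨t, a', ha', ha0', q', hq', h⟩ := ih hx (adj_mul_mem_wordSpan_length_le hq x)
      exact ⟨x :: t, a', ha', ha0', q', hq', by rw [wordAdj, mul_assoc, h]⟩
    · exact ⟨[], a, ha, ha0, q, wordSpan_mono (fun _ hu => hu.1) (Set.subset_univ _) hq,
        by rw [wordAdj, one_mul]⟩

end PositivePart

section Absorbing

variable {N : Set G} (hN : IsAbsorbing X N)
include hN

theorem exists_mul_word_mem_wordSpan_of_mem {y : NekrashevychAlgebra K G X}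
    (hy : y ∈ wordSpan K Set.univ (Set.univ : Set G)) :
    ∃ m, ∀ w : List X, m ≤ w.length → y * word K w ∈ wordSpan K Set.univ N := by
  induction hy using Submodule.span_induction with
  | mem y hy =>
    obtain ⟨u, -, g, -, rfl⟩ := hy
    obtain ⟨m, hm⟩ := hN.exists_forall_wordSection_mem g
    refine ⟨m, fun w hw => ?_⟩
    rw [mul_assoc, grp_mul_word, ← mul_assoc, ← word_append]
    exact word_mul_grp_mem_wordSpan (Set.mem_univ _) (hm w hw)
  | zero => exact ⟨0, fun w _ => by rw [zero_mul]; exact zero_mem _⟩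
  | add y z _ _ hy hz =>
    obtain ⟨m, hm⟩ := hy
    obtain ⟨n, hn⟩ := hz
    refine ⟨max m n, fun w hw => ?_⟩
    rw [add_mul]
    exact add_mem (hm w (le_of_max_le_left hw)) (hn w (le_of_max_le_right hw))
  | smul r y _ hy =>
    obtain ⟨m, hm⟩ := hy
    exact ⟨m, fun w hw => by rw [smul_mul_assoc]; exact Submodule.smul_mem _ _ (hm w hw)⟩

theorem exists_mul_word_mem_wordSpan {f : NekrashevychAlgebra K G X} (hf : f ≠ 0) :
    ∃ w : List X, f * word K w ≠ 0 ∧ f * word K w ∈ wordSpan K Set.univ N := by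
  obtain ⟨m, hm⟩ := exists_mul_word_mem_wordSpan_univ K f
  obtain ⟨v, hv, hfv⟩ := exists_mul_word_ne_zero K hf m
  obtain ⟨n, hn⟩ := exists_mul_word_mem_wordSpan_of_mem K hN (hm v hv.ge)
  obtain ⟨w, hw, hfw⟩ := exists_mul_word_ne_zero K hfv n
  rw [mul_assoc, ← word_append] at hfw
  exact ⟨v ++ w, hfw, by rw [word_append, ← mul_assoc]; exact hn w hw.ge⟩

theorem isSimpleRing_of_isAbsorbing [Nontrivial X]
    (h : ∀ a ∈ Submodule.span K (grp K '' N), a ≠ 0 → ∃ (t z : List X) (r : K),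
      t.length = z.length ∧ r ≠ 0 ∧
        compress K t z a = algebraMap K (NekrashevychAlgebra K G X) r) :
    IsSimpleRing (NekrashevychAlgebra K G X) := by
  refine IsSimpleRing.of_eq_bot_or_eq_top fun I => or_iff_not_imp_left.mpr fun hI => ?_
  obtain ⟨f, hfI, hf⟩ : ∃ f ∈ I, f ≠ 0 := by
    by_contra! hcon
    exact hI (le_bot_iff.mp fun f hf => (TwoSidedIdeal.mem_bot _).mpr (hcon f hf))
  obtain ⟨w, hw0, hw⟩ := exists_mul_word_mem_wordSpan K hN hf
  obtain ⟨L, hL⟩ := exists_length_le_of_mem_wordSpan hw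
  obtain ⟨s, a, ha, ha0, q, hq, haq⟩ := exists_wordAdj_mul_eq_add hw0 hL
  obtain ⟨t, z, r, hl, hr, hcompress⟩ := h a ha ha0
  have haqI : a + q ∈ I := haq ▸ I.mul_mem_left _ _ (I.mul_mem_right _ _ hfI)
  have hrI := compress_mem K haqI t z
  rw [map_add, hcompress] at hrI
  exact I.one_mem_iff.mp (one_mem_of_algebraMap_add_mem hr (compress_mem_positivePart hq hl) hrI)

end Absorbing

end NekrashevychAlgebra

namespace MultispinalData

variable {X G H : Type*} [Finite X] [Group G] [Finite G] [Group H] [Finite H] [MulAction H X]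

theorem nontrivial_letters (D : MultispinalData X G H) : Nontrivial X := by
  obtain ⟨x, α, hx⟩ := D.s1
  obtain ⟨y, μ, hy⟩ := D.s2
  exact ⟨x, y, fun h => by rw [h, hy] at hx; cases hx⟩

theorem smul_letter_injective (D : MultispinalData X G H) (x : X) :
    Function.Injective fun h : H => h • x := fun h k (hx : h • x = k • x) =>
  (inv_mul_eq_one.mp (D.free (k⁻¹ * h) x (by rw [mul_smul, hx, inv_smul_smul]))).symm

variable (D : MultispinalData X G H)

theorem run_inl_cons_of_inl {x : X} {α : MulAut G} (hx : D.Φ x = .inl α) (g : G) (w : List X) :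
    D.automaton.run (.inl g) (x :: w) = x :: D.automaton.run (.inl (α g)) w := by
  simp [MealyAutomaton.run, automaton, hx]

theorem run_inl_cons_of_inr {x : X} {μ : G →* H} (hx : D.Φ x = .inr μ) (g : G) (w : List X) :
    D.automaton.run (.inl g) (x :: w) = x :: D.automaton.run (.inr (μ g)) w := by
  simp [MealyAutomaton.run, automaton, hx]

theorem run_inr_one (w : List X) : D.automaton.run (.inr 1) w = w := by
  induction w with
  | nil => rfl
  | cons x w ih =>
    change (1 : H) • x :: D.automaton.run (.inr 1) w = _
    rw [ih, one_smul]

theorem run_inr_cons (h : H) (x : X) (w : List X) :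
    D.automaton.run (.inr h) (x :: w) = h • x :: w :=
  congrArg (h • x :: ·) (D.run_inr_one w)

theorem run_inr_mul (h k : H) :
    ∀ w, D.automaton.run (.inr (h * k)) w = D.automaton.run (.inr h) (D.automaton.run (.inr k) w)
  | [] => rfl
  | x :: w => by rw [run_inr_cons, run_inr_cons, run_inr_cons, mul_smul]

theorem run_inl_mul (g k : G) (w : List X) :
    D.automaton.run (.inl (g * k)) w = D.automaton.run (.inl g) (D.automaton.run (.inl k) w) := by
  induction w generalizing g k with
  | nil => rfl
  | cons x w ih =>
    cases hx : D.Φ x with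
    | inl α => simp only [D.run_inl_cons_of_inl hx, map_mul, ih]
    | inr μ => simp only [D.run_inl_cons_of_inr hx, map_mul, run_inr_mul]

/-- The state `q` of the automaton as an element of the multispinal group. -/
def state (q : G ⊕ H) : D.group :=
  ⟨D.automaton.statePerm q, Subgroup.subset_closure ⟨q, rfl⟩⟩

/-- The homomorphism from `G` to the multispinal group. -/
def ofG : G →* D.group :=
  MonoidHom.mk' (fun g => D.state (.inl g)) fun g k =>
    Subtype.ext (Equiv.ext fun w => D.run_inl_mul g k w)

/-- The homomorphism from `H` to the multispinal group. -/
def ofH : H →* D.group :=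
  MonoidHom.mk' (fun h => D.state (.inr h)) fun h k =>
    Subtype.ext (Equiv.ext fun w => D.run_inr_mul h k w)

variable {D}

theorem ofG_smul_cons_of_inl {x : X} {α : MulAut G} (hx : D.Φ x = .inl α) (g : G) (w : List X) :
    D.ofG g • (x :: w) = x :: D.ofG (α g) • w :=
  D.run_inl_cons_of_inl hx g w

theorem ofG_smul_cons_of_inr {x : X} {μ : G →* H} (hx : D.Φ x = .inr μ) (g : G) (w : List X) :
    D.ofG g • (x :: w) = x :: D.ofH (μ g) • w :=
  D.run_inl_cons_of_inr hx g w

theorem ofH_smul_cons (h : H) (x : X) (w : List X) :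
    D.ofH h • (x :: w) = h • x :: (1 : D.group) • w :=
  D.run_inr_cons h x w

theorem letterAct_ofH (h : H) (x : X) : letterAct (D.ofH h) x = h • x :=
  letterAct_eq_of (ofH_smul_cons h x)

theorem letterSection_ofH (h : H) (x : X) : letterSection (D.ofH h) x = 1 :=
  letterSection_eq_of (ofH_smul_cons h x)

theorem letterAct_ofG (g : G) (x : X) : letterAct (D.ofG g) x = x := by
  cases hx : D.Φ x with
  | inl α => exact letterAct_eq_of (ofG_smul_cons_of_inl hx g)
  | inr μ => exact letterAct_eq_of (ofG_smul_cons_of_inr hx g)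

theorem letterSection_ofG_of_inl {x : X} {α : MulAut G} (hx : D.Φ x = .inl α) (g : G) :
    letterSection (D.ofG g) x = D.ofG (α g) :=
  letterSection_eq_of (ofG_smul_cons_of_inl hx g)

theorem letterSection_ofG_of_inr {x : X} {μ : G →* H} (hx : D.Φ x = .inr μ) (g : G) :
    letterSection (D.ofG g) x = D.ofH (μ g) :=
  letterSection_eq_of (ofG_smul_cons_of_inr hx g)

theorem ofH_injective : Function.Injective D.ofH := by
  obtain ⟨x, -⟩ := D.s1
  refine Function.Injective.of_comp (f := fun γ => letterAct γ x) ?_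
  simpa only [Function.comp_def, letterAct_ofH] using D.smul_letter_injective x

variable (D) in
/-- The group `A` of condition (S3), generated by the automorphisms among the `Φ(x)`. -/
def autGroup : Subgroup (MulAut G) :=
  Subgroup.closure {β | ∃ y : X, D.Φ y = .inl β}

theorem exists_wordSection_ofG_eq {α : MulAut G} (hα : α ∈ D.autGroup) :
    ∃ w : List X, ∀ g : G, D.ofG g • w = w ∧ wordSection (D.ofG g) w = D.ofG (α g) := by
  rw [autGroup, ← Subgroup.mem_toSubmonoid, Subgroup.closure_toSubmonoid_of_finite] at hα
  induction hα using Submonoid.closure_induction with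
  | mem β hβ =>
    obtain ⟨y, hy⟩ := hβ
    exact ⟨[y], fun g => ⟨by rw [ofG_smul_cons_of_inl hy, smul_nil_word],
      letterSection_ofG_of_inl hy g⟩⟩
  | one => exact ⟨[], fun g => ⟨smul_nil_word _, rfl⟩⟩
  | mul α β _ _ hα hβ =>
    obtain ⟨u, hu⟩ := hα
    obtain ⟨v, hv⟩ := hβ
    refine ⟨v ++ u, fun g => ⟨?_, ?_⟩⟩
    · rw [smul_append_word, (hv g).1, (hv g).2, (hu _).1]
    · rw [wordSection_append, (hv g).2, (hu _).2, MulAut.mul_apply]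

theorem ofG_injective : Function.Injective D.ofG := by
  refine (injective_iff_map_eq_one _).mpr fun g hg => D.s3 g fun x μ hx α hα => ?_
  obtain ⟨w, hw⟩ := exists_wordSection_ofG_eq (D := D) hα
  have hαg : D.ofG (α g) = 1 := by
    rw [← (hw g).2, hg, ← map_one D.ofG, (hw 1).2, map_one]
  refine ofH_injective (D := D) ?_
  rw [map_one, ← letterSection_ofG_of_inr hx, hαg, letterSection_one]

variable (D) in
/-- The nucleus of a multispinal group: the set of elements given by the states. -/
def nucleus : Set D.group :=
  Set.range D.ofG ∪ Set.range D.ofH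

theorem ofG_mem_nucleus (g : G) : D.ofG g ∈ D.nucleus := .inl ⟨g, rfl⟩

theorem ofH_mem_nucleus (h : H) : D.ofH h ∈ D.nucleus := .inr ⟨h, rfl⟩

theorem one_mem_nucleus : 1 ∈ D.nucleus := .inl ⟨1, map_one _⟩

theorem finite_nucleus : D.nucleus.Finite :=
  (Set.finite_range _).union (Set.finite_range _)

theorem letterSection_ofG_mem_nucleus (g : G) (x : X) :
    letterSection (D.ofG g) x ∈ D.nucleus := by
  cases hx : D.Φ x with
  | inl α => rw [letterSection_ofG_of_inl hx]; exact ofG_mem_nucleus _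
  | inr μ => rw [letterSection_ofG_of_inr hx]; exact ofH_mem_nucleus _

theorem letterSection_mem_nucleus {s : D.group} (hs : s ∈ D.nucleus) (x : X) :
    letterSection s x ∈ D.nucleus := by
  obtain ⟨g, rfl⟩ | ⟨h, rfl⟩ := hs
  · exact letterSection_ofG_mem_nucleus g x
  · rw [letterSection_ofH]; exact one_mem_nucleus

theorem wordSection_mem_nucleus {s : D.group} (hs : s ∈ D.nucleus) (w : List X) :
    wordSection s w ∈ D.nucleus :=
  wordSection_mem_of_letterSection_mem letterSection_mem_nucleus hs w

theorem letterSection_mul_mem_nucleus {s t : D.group} (hs : s ∈ D.nucleus) (ht : t ∈ D.nucleus)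
    (x : X) : letterSection (s * t) x ∈ D.nucleus := by
  rw [letterSection_mul]
  obtain ⟨k, rfl⟩ | ⟨k, rfl⟩ := ht
  · obtain ⟨g, rfl⟩ | ⟨h, rfl⟩ := hs
    · rw [← letterSection_mul, ← map_mul]; exact letterSection_ofG_mem_nucleus _ x
    · rw [letterSection_ofH, one_mul]; exact letterSection_ofG_mem_nucleus k x
  · rw [letterSection_ofH, mul_one]; exact letterSection_mem_nucleus hs _

theorem nucleus_mul_induction {p : D.group → Prop} (one : p 1)
    (mul : ∀ s ∈ D.nucleus, ∀ γ, p γ → p (s * γ)) (γ : D.group) : p γ := by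
  have mul_state (q : G ⊕ H) (γ : D.group) (hγ : p γ) :
      p (D.state q * γ) ∧ p ((D.state q)⁻¹ * γ) := by
    obtain g | h := q
    · have hinv := mul _ (ofG_mem_nucleus g⁻¹) γ hγ
      rw [map_inv] at hinv
      exact ⟨mul _ (ofG_mem_nucleus g) γ hγ, hinv⟩
    · have hinv := mul _ (ofH_mem_nucleus h⁻¹) γ hγ
      rw [map_inv] at hinv
      exact ⟨mul _ (ofH_mem_nucleus h) γ hγ, hinv⟩
  obtain ⟨γ, hγ⟩ := γ
  induction hγ using Subgroup.closure_induction_left with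
  | one => exact one
  | mul_left s hs γ hγ ih =>
    obtain ⟨q, rfl⟩ := hs
    exact (mul_state q ⟨γ, hγ⟩ ih).1
  | inv_mul_cancel s hs γ hγ ih =>
    obtain ⟨q, rfl⟩ := hs
    exact (mul_state q ⟨γ, hγ⟩ ih).2

variable (D) in
theorem isAbsorbing_nucleus : IsAbsorbing X D.nucleus where
  letterSection_mem := letterSection_mem_nucleus
  exists_wordSection_mem γ := by
    induction γ using nucleus_mul_induction with
    | one => exact ⟨0, fun w _ => wordSection_mem_nucleus one_mem_nucleus w⟩
    | mul s hs γ ih =>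
      obtain ⟨n, hn⟩ := ih
      refine ⟨n + 1, fun w hw => ?_⟩
      obtain ⟨x, hx⟩ : ∃ x, w.drop n = [x] := List.length_eq_one_iff.mp (by simp [hw])
      rw [← List.take_append_drop n w, wordSection_append, wordSection_mul, hx]
      exact letterSection_mul_mem_nucleus (wordSection_mem_nucleus hs _) (hn _ (by simp [hw])) x

variable (D) in
theorem isContracting : IsContracting D.group X :=
  D.isAbsorbing_nucleus.isContracting finite_nucleus

theorem exists_letterSection_eq_letterSection_ofG {x y : X} (h : H) (hxy : h • x = y) (g : G) :
    ∃ γ : D.group, letterAct γ x = x ∧ letterSection γ x = letterSection (D.ofG g) y := by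
  refine ⟨D.ofH h⁻¹ * (D.ofG g * D.ofH h), ?_, ?_⟩
  · rw [letterAct_mul, letterAct_mul, letterAct_ofH, letterAct_ofG, letterAct_ofH, inv_smul_smul]
  · rw [letterSection_mul, letterSection_mul, letterSection_ofH, letterSection_ofH, letterAct_ofH,
      hxy, one_mul, mul_one]

theorem exists_letterSection_ofG_eq
    (hsurj : ∃ (x : X) (μ : G →* H), D.Φ x = .inr μ ∧ Function.Surjective μ)
    {s : D.group} (hs : s ∈ D.nucleus) : ∃ (g : G) (x : X), letterSection (D.ofG g) x = s := by
  obtain ⟨g, rfl⟩ | ⟨h, rfl⟩ := hs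
  · obtain ⟨x, α, hx⟩ := D.s1
    exact ⟨α.symm g, x, by rw [letterSection_ofG_of_inl hx, MulEquiv.apply_symm_apply]⟩
  · obtain ⟨x, μ, hx, hμ⟩ := hsurj
    obtain ⟨g, rfl⟩ := hμ h
    exact ⟨g, x, letterSection_ofG_of_inr hx g⟩

theorem isSelfReplicating [MulAction.IsPretransitive H X]
    (hsurj : ∃ (x : X) (μ : G →* H), D.Φ x = .inr μ ∧ Function.Surjective μ) :
    IsSelfReplicating D.group X := by
  refine isSelfReplicating_of_letterAct_transitive (fun x y => ?_) fun x γ => ?_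
  · obtain ⟨h, hh⟩ := MulAction.exists_smul_eq H x y
    exact ⟨D.ofH h, by rw [letterAct_ofH, hh]⟩
  induction γ using nucleus_mul_induction with
  | one => exact ⟨1, letterAct_one x, letterSection_one x⟩
  | mul s hs γ ih =>
    obtain ⟨g, y, rfl⟩ := exists_letterSection_ofG_eq hsurj hs
    obtain ⟨h, hh⟩ := MulAction.exists_smul_eq H x y
    obtain ⟨a, ha, ha'⟩ := exists_letterSection_eq_letterSection_ofG h hh g
    obtain ⟨b, hb, hb'⟩ := ih
    exact ⟨a * b, by rw [letterAct_mul, hb, ha], by rw [letterSection_mul, hb, ha', hb']⟩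

end MultispinalData

section Simplicity

open NekrashevychAlgebra

namespace MultispinalData

variable {X G H : Type*} [Fintype X] [Group G] [Finite G] [Group H] [Finite H] [MulAction H X]
  (D : MultispinalData X G H) (K : Type*) [Field K]

/-- The homomorphism from the group algebra `K[G]` to the Nekrashevych algebra. -/
noncomputable def algG : MonoidAlgebra K G →ₐ[K] NekrashevychAlgebra K D.group X :=
  MonoidAlgebra.lift K _ G ((grp K).comp D.ofG)

/-- The homomorphism from the group algebra `K[H]` to the Nekrashevych algebra. -/
noncomputable def algH : MonoidAlgebra K H →ₐ[K] NekrashevychAlgebra K D.group X :=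
  MonoidAlgebra.lift K _ H ((grp K).comp D.ofH)

/-- The maps `K[G] → K[H]` induced by the elements `μ ∘ α` of the set `B` of condition (S3) are
jointly injective. (Condition (S3) says that the maps `μ ∘ α` themselves are.) -/
def IsSeparating : Prop :=
  ∀ a : MonoidAlgebra K G, (∀ (x : X) (μ : G →* H), D.Φ x = .inr μ → ∀ α ∈ D.autGroup,
    MonoidAlgebra.mapDomain (μ ∘ α) a = 0) → a = 0

variable {D K}

theorem isSeparating_of_injective {x : X} {μ : G →* H} (hx : D.Φ x = .inr μ)
    (hμ : Function.Injective μ) : D.IsSeparating K := fun a ha =>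
  MonoidAlgebra.mapDomain_injective hμ (by
    simpa [Function.comp_def] using ha x μ hx 1 (one_mem _))

variable (D K) in
theorem algG_single (g : G) (r : K) : D.algG K (.single g r) = r • grp K (D.ofG g) :=
  MonoidAlgebra.lift_single _ _ _

variable (D K) in
theorem algH_single (h : H) (r : K) : D.algH K (.single h r) = r • grp K (D.ofH h) :=
  MonoidAlgebra.lift_single _ _ _

theorem exists_algG_add_algH_eq {y : NekrashevychAlgebra K D.group X}
    (hy : y ∈ Submodule.span K (grp K '' D.nucleus)) : ∃ a c, D.algG K a + D.algH K c = y := by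
  have hle : Submodule.span K (grp K '' D.nucleus) ≤
      LinearMap.range (D.algG K).toLinearMap ⊔ LinearMap.range (D.algH K).toLinearMap := by
    rw [Submodule.span_le]
    rintro _ ⟨_, ⟨g, rfl⟩ | ⟨h, rfl⟩, rfl⟩
    · exact Submodule.mem_sup_left ⟨.single g 1, by simp [algG_single]⟩
    · exact Submodule.mem_sup_right ⟨.single h 1, by simp [algH_single]⟩
  obtain ⟨_, ⟨a, rfl⟩, _, ⟨c, rfl⟩, h⟩ := Submodule.mem_sup.mp (hle hy)
  exact ⟨a, c, h⟩

theorem compress_algH (h : H) (x : X) (c : MonoidAlgebra K H) :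
    compress K [h • x] [x] (D.algH K c) = algebraMap K _ (c.coeff h) := by
  induction c using MonoidAlgebra.induction_linear with
  | zero => simp
  | add c c' hc hc' => simp [hc, hc']
  | single k r =>
    rw [algH_single, map_smul]
    obtain rfl | hk := eq_or_ne k h
    · rw [compress_grp_of_smul_eq K (by rw [smul_singleton_word, letterAct_ofH])]
      simp [wordSection, letterSection_ofH, Algebra.algebraMap_eq_smul_one]
    · have hne : D.ofH k • [x] ≠ [h • x] := by
        rw [smul_singleton_word, letterAct_ofH]
        exact fun hx => hk (smul_letter_injective D x (List.cons.inj hx).1)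
      rw [compress_grp_of_smul_ne K (by simp) hne]
      simp [hk]

theorem compress_algG_of_ne_one {h : H} (hh : h ≠ 1) (x : X) (a : MonoidAlgebra K G) :
    compress K [h • x] [x] (D.algG K a) = 0 := by
  induction a using MonoidAlgebra.induction_linear with
  | zero => simp
  | add a b ha hb => simp [ha, hb]
  | single g r =>
    have hne : D.ofG g • [x] ≠ [h • x] := by
      rw [smul_singleton_word, letterAct_ofG]
      exact fun hx => hh (D.free h x (List.cons.inj hx).1.symm)
    rw [algG_single, map_smul, compress_grp_of_smul_ne K (by simp) hne, smul_zero]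

theorem exists_compress_algG_eq_algH {x : X} {μ : G →* H} (hx : D.Φ x = .inr μ) {α : MulAut G}
    (hα : α ∈ D.autGroup) : ∃ w : List X, ∀ a : MonoidAlgebra K G,
      compress K w w (D.algG K a) = D.algH K (MonoidAlgebra.mapDomain (μ ∘ α) a) := by
  obtain ⟨w, hw⟩ := exists_wordSection_ofG_eq hα
  refine ⟨w ++ [x], fun a => ?_⟩
  induction a using MonoidAlgebra.induction_linear with
  | zero => simp
  | add a b ha hb => simp [ha, hb, MonoidAlgebra.mapDomain_add]
  | single g r =>
    rw [algG_single, map_smul, compress_append, compress_grp_of_smul_eq K (hw g).1, (hw g).2,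
      compress_grp_of_smul_eq K (by rw [smul_singleton_word, letterAct_ofG]),
      MonoidAlgebra.mapDomain_single, algH_single]
    simp [wordSection, letterSection_ofG_of_inr hx]

theorem exists_compress_algG_eq_algebraMap (hD : D.IsSeparating K) {a : MonoidAlgebra K G}
    (ha : a ≠ 0) : ∃ (t z : List X) (r : K), t.length = z.length ∧ r ≠ 0 ∧
      compress K t z (D.algG K a) = algebraMap K _ r := by
  obtain ⟨x, μ, hx, α, hα, hne⟩ : ∃ (x : X) (μ : G →* H), D.Φ x = .inr μ ∧ ∃ α ∈ D.autGroup,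
      MonoidAlgebra.mapDomain (μ ∘ α) a ≠ 0 := by
    contrapose! ha
    exact hD a ha
  obtain ⟨h, hh⟩ : ∃ h, (MonoidAlgebra.mapDomain (μ ∘ α) a).coeff h ≠ 0 := by
    contrapose! hne
    exact MonoidAlgebra.coeff_injective (Finsupp.ext hne)
  obtain ⟨w, hw⟩ := exists_compress_algG_eq_algH (K := K) hx hα
  exact ⟨w ++ [h • x], w ++ [x], _, by simp, hh, by rw [compress_append, hw, compress_algH]⟩

theorem isSimpleRing_of_isSeparating (hD : D.IsSeparating K) :
    IsSimpleRing (NekrashevychAlgebra K D.group X) := by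
  have : Nontrivial X := D.nontrivial_letters
  refine isSimpleRing_of_isAbsorbing K D.isAbsorbing_nucleus fun y hy hy0 => ?_
  obtain ⟨a, c, rfl⟩ := exists_algG_add_algH_eq hy
  by_cases hc : ∃ h ≠ 1, c.coeff h ≠ 0
  · obtain ⟨h, h1, hh⟩ := hc
    obtain ⟨x, -⟩ := D.s1
    exact ⟨[h • x], [x], _, rfl, hh, by
      rw [map_add, compress_algG_of_ne_one h1, compress_algH, zero_add]⟩
  · have hc_eq : c = algebraMap K _ (c.coeff 1) := by
      ext h
      by_cases h1 : h = 1
      · simp [h1]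
      · push Not at hc
        simp [hc h h1, h1]
    rw [hc_eq, AlgHom.commutes, ← (D.algG K).commutes, ← map_add] at hy0 ⊢
    exact exists_compress_algG_eq_algebraMap hD fun h0 => hy0 (by rw [h0, map_zero])

end MultispinalData

end Simplicity

section NonSimplicity

open NekrashevychAlgebra Filter

theorem sum_comp_eq_zero_of_card_ker_eq_zero {G H K : Type*} [Group G] [Fintype G] [Group H]
    [Ring K] {μ : G →* H} (hμ : (Nat.card μ.ker : K) = 0) (f : H → K) : ∑ g, f (μ g) = 0 := by
  classical
  rw [Finset.sum_comp]
  refine Finset.sum_eq_zero fun h hh => ?_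
  have hcard : Finset.card {g | μ g = h} = Nat.card μ.ker := by
    rw [MonoidHom.card_fiber_eq_of_mem_range μ (by simpa using hh) (one_mem μ.range),
      ← Fintype.card_subtype, ← Nat.card_eq_fintype_card]
    rfl
  rw [hcard, nsmul_eq_mul, hμ, zero_mul]

namespace MultispinalData

section Streams

variable {X G H : Type*} [Finite X] [Group G] [Finite G] [Group H] [Finite H] [MulAction H X]
  {D : MultispinalData X G H}

theorem ofG_smul_cons_stream_of_inl {x : X} {α : MulAut G} (hx : D.Φ x = .inl α) (g : G)
    (ξ : Stream' X) : D.ofG g • Stream'.cons x ξ = Stream'.cons x (D.ofG (α g) • ξ) := by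
  rw [smul_cons_stream, letterAct_ofG, letterSection_ofG_of_inl hx]

theorem ofG_smul_cons_stream_of_inr {x : X} {μ : G →* H} (hx : D.Φ x = .inr μ) (g : G)
    (ξ : Stream' X) : D.ofG g • Stream'.cons x ξ = Stream'.cons x (D.ofH (μ g) • ξ) := by
  rw [smul_cons_stream, letterAct_ofG, letterSection_ofG_of_inr hx]

theorem ofG_smul_stream_of_forall_inl {ξ : Stream' X} (hξ : ∀ n, ∃ α, D.Φ (ξ.get n) = .inl α)
    (g : G) : D.ofG g • ξ = ξ := by
  refine Stream'.ext fun n => ?_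
  induction n generalizing g ξ with
  | zero =>
    obtain ⟨α, hα⟩ := hξ 0
    rw [← ξ.eta, ofG_smul_cons_stream_of_inl hα]
    rfl
  | succ n ih =>
    obtain ⟨α, hα⟩ := hξ 0
    rw [← ξ.eta, ofG_smul_cons_stream_of_inl hα, Stream'.get_succ_cons, Stream'.get_succ_cons,
      ih (ξ := ξ.tail) fun n => hξ (n + 1)]

end Streams

section StreamSums

variable {X G H : Type*} [Finite X] [Group G] [Fintype G] [Group H] [Finite H] [MulAction H X]
  {D : MultispinalData X G H} {K : Type*} [Ring K]

theorem sum_ofG_smul_stream_eq_zero_of_inr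
    (hD : ∀ (x : X) (μ : G →* H), D.Φ x = .inr μ → (Nat.card μ.ker : K) = 0)
    (f : Stream' X → K) {ξ : Stream' X} {n : ℕ} {μ : G →* H} (hn : D.Φ (ξ.get n) = .inr μ) :
    ∑ g, f (D.ofG g • ξ) = 0 := by
  induction n generalizing f ξ with
  | zero =>
    rw [← ξ.eta]
    simp only [ofG_smul_cons_stream_of_inr hn]
    exact sum_comp_eq_zero_of_card_ker_eq_zero (hD _ μ hn)
      fun h => f (Stream'.cons ξ.head (D.ofH h • ξ.tail))
  | succ n ih =>
    rw [← ξ.eta]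
    cases hx : D.Φ ξ.head with
    | inl α =>
      simp only [ofG_smul_cons_stream_of_inl hx]
      exact (α.toEquiv.sum_comp fun g => f (Stream'.cons ξ.head (D.ofG g • ξ.tail))).trans
        (ih (fun η => f (Stream'.cons ξ.head η)) hn)
    | inr ν =>
      simp only [ofG_smul_cons_stream_of_inr hx]
      exact sum_comp_eq_zero_of_card_ker_eq_zero (hD _ ν hx)
        fun h => f (Stream'.cons ξ.head (D.ofH h • ξ.tail))

theorem sum_ofG_smul_stream_eq_zero
    (hD : ∀ (x : X) (μ : G →* H), D.Φ x = .inr μ → (Nat.card μ.ker : K) = 0)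
    (f : Stream' X → K) (ξ : Stream' X) : ∑ g, f (D.ofG g • ξ) = 0 := by
  by_cases hξ : ∃ n μ, D.Φ (ξ.get n) = .inr μ
  · obtain ⟨n, μ, hn⟩ := hξ
    exact sum_ofG_smul_stream_eq_zero_of_inr hD f hn
  · have hfix (g : G) : D.ofG g • ξ = ξ := by
      refine ofG_smul_stream_of_forall_inl (fun n => ?_) g
      cases hn : D.Φ (ξ.get n) with
      | inl α => exact ⟨α, rfl⟩
      | inr μ => exact absurd ⟨n, μ, hn⟩ hξ
    obtain ⟨x, μ, hx⟩ := D.s2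
    simp only [hfix]
    exact sum_comp_eq_zero_of_card_ker_eq_zero (hD x μ hx) fun _ => f ξ

end StreamSums

section Germs

variable {X G H : Type*} [Finite X] [Group G] [Finite G] [Group H] [Finite H] [MulAction H X]
  {D : MultispinalData X G H}

theorem ofG_smul_replicate_append {x : X} {α : MulAut G} (hx : D.Φ x = .inl α) (k : ℕ) (g : G)
    (w : List X) : D.ofG g • (List.replicate k x ++ w) =
      List.replicate k x ++ D.ofG ((α ^ k) g) • w := by
  induction k generalizing g with
  | zero => rfl
  | succ k ih =>
    rw [List.replicate_succ, List.cons_append, ofG_smul_cons_of_inl hx, ih, pow_succ]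
    rfl

variable (D) in
theorem exists_regularGerm_ofG_smul_ne : ∃ (l : Filter (ℕ × List X)) (_ : l.NeBot)
    (φ : regularGerms D.group X l), ∀ g : G, g ≠ 1 → D.ofG g • φ ≠ φ := by
  obtain ⟨x, α, hx⟩ := D.s1
  let l : Filter (ℕ × List X) := comap Prod.fst atTop
  have : l.NeBot := NeBot.comap_of_surj inferInstance Prod.fst_surjective
  let f : ℕ × List X → List X := fun ω => List.replicate ω.1 x ++ ω.2
  have hf : (f : Germ l (List X)) ∈ regularGerms D.group X l := by
    refine coe_mem_regularGerms.mpr fun n => ⟨List.replicate n x, List.length_replicate, ?_⟩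
    filter_upwards [tendsto_comap.eventually (eventually_ge_atTop n)] with ω hω
    obtain ⟨k, hk⟩ := Nat.exists_eq_add_of_le hω
    exact ⟨List.replicate k x ++ ω.2, by
      rw [← List.append_assoc, List.replicate_append_replicate, ← hk]⟩
  refine ⟨l, this, ⟨f, hf⟩, fun g hg hfix => hg ?_⟩
  have hev : ∀ᶠ ω in l, D.ofG g • f ω = f ω := Germ.coe_eq.mp (congrArg Subtype.val hfix)
  obtain ⟨k, hk⟩ := (eventually_comap.mp hev).exists
  have hone : D.ofG ((α ^ k) g) = 1 := by
    refine FaithfulSMul.eq_of_smul_eq_smul (α := List X) fun w => ?_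
    have := hk (k, w) rfl
    rwa [ofG_smul_replicate_append hx, List.append_cancel_left_eq, ← one_smul D.group w] at this
  rwa [← map_one D.ofG, ofG_injective.eq_iff, EmbeddingLike.map_eq_one_iff] at hone

end Germs

variable {X G H : Type*} [Fintype X] [Group G] [Group H] [Finite H] [MulAction H X]

theorem sum_grp_ofG_ne_zero [Fintype G] (D : MultispinalData X G H) (K : Type*) [Field K] :
    ∑ g, grp K (D.ofG g) ≠ (0 : NekrashevychAlgebra K D.group X) := by
  classical
  obtain ⟨l, _, φ, hφ⟩ := D.exists_regularGerm_ofG_smul_ne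
  have heval : germRep K D.group X l (∑ g, grp K (D.ofG g)) (Pi.single φ 1) φ = 1 := by
    rw [map_sum, LinearMap.sum_apply, Finset.sum_apply, Finset.sum_eq_single 1]
    · rw [germRep_grp_apply, map_one, inv_one, one_smul, Pi.single_eq_same]
    · intro g _ hg
      rw [germRep_grp_apply, ← map_inv, Pi.single_eq_of_ne (hφ _ (inv_ne_one.mpr hg))]
    · simp
  intro h0
  rw [h0, map_zero] at heval
  exact zero_ne_one heval

theorem not_isSimpleRing_of_card_ker_eq_zero [Finite G] {D : MultispinalData X G H} {K : Type*}
    [Field K] (hD : ∀ (x : X) (μ : G →* H), D.Φ x = .inr μ → (Nat.card μ.ker : K) = 0) :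
    ¬ IsSimpleRing (NekrashevychAlgebra K D.group X) := by
  cases nonempty_fintype G
  intro hsimple
  have : Nonempty X := D.nontrivial_letters.to_nonempty
  have : Nonempty (Stream' X) := ⟨Stream'.const (Classical.arbitrary X)⟩
  refine D.sum_grp_ofG_ne_zero K ((streamRep K D.group X).toRingHom.injective ?_)
  rw [map_zero]
  refine LinearMap.ext fun f => funext fun ξ => ?_
  change streamRep K D.group X (∑ g, grp K (D.ofG g)) f ξ = 0
  simp only [map_sum, LinearMap.sum_apply, Finset.sum_apply, streamRep_grp_apply, ← map_inv]
  exact (Equiv.sum_comp (Equiv.inv G) fun g => f (D.ofG g • ξ)).trans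
    (sum_ofG_smul_stream_eq_zero hD f ξ)

end MultispinalData

end NonSimplicity

section FourierInversion

variable {ι R L : Type*} [Fintype ι] [DecidableEq ι] [CommRing R] [Fintype R] [CommRing L]
  [IsDomain L] {ψ : AddChar R L}

theorem sum_addChar_dotProduct_eq_zero (hψ : ψ.IsPrimitive) {v : ι → R} (hv : v ≠ 0) :
    ∑ r : ι → R, ψ (r ⬝ᵥ v) = 0 := by
  obtain ⟨i, hi⟩ := Function.ne_iff.mp hv
  obtain ⟨s, hs⟩ := AddChar.ne_one_iff.mp (hψ hi)
  let χ : AddChar (ι → R) L :=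
    ψ.compAddMonoidHom ⟨⟨(· ⬝ᵥ v), zero_dotProduct v⟩, (add_dotProduct · · v)⟩
  refine AddChar.sum_eq_zero_of_ne_one (ψ := χ) (AddChar.ne_one_iff.mpr ⟨Pi.single i s, ?_⟩)
  change ψ (Pi.single i s ⬝ᵥ v) ≠ 1
  rwa [single_dotProduct, mul_comm]

theorem eq_zero_of_sum_mul_addChar_dotProduct_eq_zero (hψ : ψ.IsPrimitive)
    (hR : (Fintype.card R : L) ≠ 0) {f : (ι → R) → L}
    (hf : ∀ r : ι → R, ∑ v, f v * ψ (r ⬝ᵥ v) = 0) : f = 0 := by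
  classical
  funext w
  have hsum : f w * (Fintype.card R : L) ^ Fintype.card ι = 0 := by
    calc f w * (Fintype.card R : L) ^ Fintype.card ι
        = ∑ v, f v * ∑ r : ι → R, ψ (r ⬝ᵥ (v - w)) := by
          rw [Finset.sum_eq_single w]
          · simp
          · intro v _ hv
            rw [sum_addChar_dotProduct_eq_zero hψ (sub_ne_zero.mpr hv), mul_zero]
          · simp
      _ = ∑ r : ι → R, (∑ v, f v * ψ (r ⬝ᵥ v)) * ψ (-(r ⬝ᵥ w)) := by
          simp only [Finset.mul_sum, Finset.sum_mul, mul_assoc, ← AddChar.map_add_eq_mul,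
            ← sub_eq_add_neg, ← dotProduct_sub]
          exact Finset.sum_comm
      _ = 0 := by simp only [hf, zero_mul, Finset.sum_const_zero]
  exact (mul_eq_zero.mp hsum).resolve_right (pow_ne_zero _ hR)

end FourierInversion

theorem sum_algebraMap_coeff_mul_comp {G H K L : Type*} [Fintype G] [Fintype H] [CommSemiring K]
    [CommSemiring L] [Algebra K L] (μ : G → H) (a : MonoidAlgebra K G) (f : H → L) :
    ∑ g, algebraMap K L (a.coeff g) * f (μ g) =
      ∑ h, algebraMap K L ((MonoidAlgebra.mapDomain μ a).coeff h) * f h := by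
  classical
  induction a using MonoidAlgebra.induction_linear with
  | zero => simp
  | add a b ha hb => simp only [MonoidAlgebra.coeff_add, MonoidAlgebra.mapDomain_add,
      Finsupp.add_apply, map_add, add_mul, Finset.sum_add_distrib, ha, hb]
  | single g r => simp [MonoidAlgebra.mapDomain_single, Finsupp.single_apply, apply_ite]

section SpinalGroups

open scoped MatrixGroups

open MultispinalData

theorem matAut_apply {n : ℕ} (M : Matrix.SpecialLinearGroup (Fin 2) (ZMod n))
    (g : Multiplicative (Fin 2 → ZMod n)) : (matAut M g).toAdd = M.1.mulVec g.toAdd :=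
  rfl

theorem rowHom_apply {n : ℕ} (r : Fin 2 → ZMod n) (g : Multiplicative (Fin 2 → ZMod n)) :
    (rowHom r g).toAdd = r ⬝ᵥ g.toAdd :=
  rfl

theorem exists_eq_rowHom_of_spinalPhi_eq_inr {n : ℕ} {k : ZMod n}
    {μ : Multiplicative (Fin 2 → ZMod n) →* Multiplicative (ZMod n)}
    (h : spinalPhi n k = .inr μ) : ∃ c : ZMod n, μ = rowHom ![0, c] := by
  unfold spinalPhi at h
  split_ifs at h
  · exact ⟨1, (Sum.inr.inj h).symm⟩
  · exact ⟨0, (Sum.inr.inj h).symm⟩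

theorem dvd_card_ker_rowHom {n : ℕ} (c : ZMod n) : n ∣ Nat.card (rowHom ![0, c]).ker := by
  let f : Multiplicative (ZMod n) →* (rowHom ![0, c]).ker :=
    (AddMonoidHom.single (fun _ : Fin 2 => ZMod n) 0).toMultiplicative.codRestrict _ fun a =>
      Multiplicative.toAdd.injective (by simp [rowHom_apply])
  have hf : Function.Injective f := fun a b h =>
    Pi.single_injective (M := fun _ : Fin 2 => ZMod n) 0 (congrArg Subtype.val h)
  simpa only [Nat.card_congr Multiplicative.toAdd, Nat.card_zmod] using
    Subgroup.card_dvd_of_injective f hf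

theorem exists_smul_bottom_row_eq (r : Fin 2 → ℤ) :
    ∃ (d : ℤ) (M : SL(2, ℤ)), d • (M : Matrix (Fin 2) (Fin 2) ℤ) 1 = r := by
  obtain ⟨s, t, hs, ht, hst⟩ := extract_gcd (r 0) (r 1)
  obtain ⟨M, -, hM⟩ := ModularGroup.bottom_row_surj
    (show ![s, t] ∈ {cd : Fin 2 → ℤ | IsCoprime (cd 0) (cd 1)} from (gcd_isUnit_iff s t).mp hst)
  refine ⟨gcd (r 0) (r 1), M, ?_⟩
  change _ • (fun g : SL(2, ℤ) => (g : Matrix (Fin 2) (Fin 2) ℤ) 1) M = r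
  rw [hM]
  ext i
  fin_cases i
  exacts [hs.symm, ht.symm]

theorem closure_elementary_eq_top {E F : SL(2, ℤ)} (hE : E.1 = !![1, 1; 0, 1])
    (hF : F.1 = !![1, 0; 1, 1]) : Subgroup.closure {E, F} = ⊤ := by
  have hT : ModularGroup.T = E := Subtype.ext hE.symm
  have hS : ModularGroup.S = E⁻¹ * F * E⁻¹ := by
    apply Subtype.ext
    simp [Matrix.SpecialLinearGroup.coe_mul, Matrix.SpecialLinearGroup.coe_inv, hE, hF,
      ModularGroup.S]
  have hE_mem : E ∈ Subgroup.closure {E, F} := Subgroup.subset_closure (by simp)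
  have hF_mem : F ∈ Subgroup.closure {E, F} := Subgroup.subset_closure (by simp)
  rw [eq_top_iff, ← SpecialLinearGroup.SL2Z_generators, Subgroup.closure_le]
  rintro _ (rfl | rfl)
  · rw [hS]
    exact mul_mem (mul_mem (inv_mem hE_mem) hF_mem) (inv_mem hE_mem)
  · rwa [hT]

/-- The action of `SL₂(ℤ)` on the column vectors `(ℤ/n)²`. -/
def intMatAut (n : ℕ) : SL(2, ℤ) →* MulAut (Multiplicative (Fin 2 → ZMod n)) :=
  MonoidHom.mk' (fun M => matAut (M.map (Int.castRingHom (ZMod n)))) fun M N =>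
    MulEquiv.ext fun g => Multiplicative.toAdd.injective (by
      rw [MulAut.mul_apply, matAut_apply, matAut_apply, matAut_apply, Matrix.mulVec_mulVec,
        map_mul, Matrix.SpecialLinearGroup.coe_mul])

theorem rowHom_intMatAut {n : ℕ} (M : SL(2, ℤ)) (g : Multiplicative (Fin 2 → ZMod n)) :
    (rowHom ![0, 1] (intMatAut n M g)).toAdd = (fun i => (M.1 1 i : ZMod n)) ⬝ᵥ g.toAdd := by
  change (![0, 1] : Fin 2 → ZMod n) ⬝ᵥ
    (M.map (Int.castRingHom (ZMod n))).1.mulVec g.toAdd = _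
  simp [Matrix.mulVec, dotProduct]

variable (n : ℕ) [Fact (2 < n)]

theorem not_isSimpleRing_spinalGroup (K : Type*) [Field K] (hn : (n : K) = 0) :
    ¬ IsSimpleRing (NekrashevychAlgebra K (spinalGroup n) (ZMod n)) := by
  refine not_isSimpleRing_of_card_ker_eq_zero fun x μ hx => ?_
  obtain ⟨c, rfl⟩ := exists_eq_rowHom_of_spinalPhi_eq_inr hx
  obtain ⟨k, hk⟩ := dvd_card_ker_rowHom c
  rw [hk, Nat.cast_mul, hn, zero_mul]

theorem intMatAut_mem_autGroup (M : SL(2, ℤ)) : intMatAut n M ∈ (spinalData n).autGroup := by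
  have : Fact (1 < n) := ⟨one_lt_two.trans Fact.out⟩
  let E : SL(2, ℤ) := ⟨!![1, 1; 0, 1], by simp⟩
  let F : SL(2, ℤ) := ⟨!![1, 0; 1, 1], by simp⟩
  have hle : Subgroup.closure {E, F} ≤ (spinalData n).autGroup.comap (intMatAut n) := by
    rw [Subgroup.closure_le]
    rintro _ (rfl | rfl)
    · refine Subgroup.subset_closure ⟨0, (if_pos rfl).trans (congrArg (Sum.inl ∘ matAut) ?_)⟩
      ext i j
      change _ = ((E.1 i j : ℤ) : ZMod n)
      fin_cases i <;> fin_cases j <;> simp [E]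
    · refine Subgroup.subset_closure ⟨1, ((if_neg one_ne_zero).trans (if_pos rfl)).trans
        (congrArg (Sum.inl ∘ matAut) ?_)⟩
      ext i j
      change _ = ((F.1 i j : ℤ) : ZMod n)
      fin_cases i <;> fin_cases j <;> simp [F]
  rw [closure_elementary_eq_top rfl rfl] at hle
  exact hle (Subgroup.mem_top M)

theorem exists_smul_rowHom_eq (r : Fin 2 → ZMod n) :
    ∃ d : ZMod n, ∃ α ∈ (spinalData n).autGroup, ∀ g : Multiplicative (Fin 2 → ZMod n),
      d * (rowHom ![0, 1] (α g)).toAdd = r ⬝ᵥ g.toAdd := by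
  obtain ⟨d, M, hdM⟩ := exists_smul_bottom_row_eq fun i => (r i).cast
  refine ⟨d, _, intMatAut_mem_autGroup n M, fun g => ?_⟩
  have hr : r = (d : ZMod n) • fun i => (M.1 1 i : ZMod n) := by
    ext i
    simpa using congrArg (Int.cast : ℤ → ZMod n) (congrFun hdM i).symm
  rw [rowHom_intMatAut, hr, smul_dotProduct, smul_eq_mul]

theorem isSeparating_spinalData (K : Type*) [Field K] (hn : (n : K) ≠ 0) :
    (spinalData n).IsSeparating K := by
  intro a ha
  obtain ⟨L, _, _, ψ, hψ⟩ : ∃ (L : Type _) (_ : Field L) (_ : Algebra K L)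
      (ψ : AddChar (ZMod n) L), ψ.IsPrimitive :=
    let Ψ := AddChar.primitiveZModChar ⟨n, NeZero.pos n⟩ K hn
    ⟨_, inferInstance, inferInstance, Ψ.char, Ψ.prim⟩
  have hnL : (Fintype.card (ZMod n) : L) ≠ 0 := by
    rw [ZMod.card, ← map_natCast (algebraMap K L)]
    exact (map_ne_zero (algebraMap K L)).mpr hn
  have hfourier (r : Fin 2 → ZMod n) :
      ∑ v, algebraMap K L (a.coeff (.ofAdd v)) * ψ (r ⬝ᵥ v) = 0 := by
    obtain ⟨d, α, hα, hr⟩ := exists_smul_rowHom_eq n r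
    calc ∑ v, algebraMap K L (a.coeff (.ofAdd v)) * ψ (r ⬝ᵥ v)
        = ∑ g, algebraMap K L (a.coeff g) * ψ (d * (rowHom ![0, 1] (α g)).toAdd) := by
          simp only [hr]
          exact Equiv.sum_comp Multiplicative.ofAdd
            fun g => algebraMap K L (a.coeff g) * ψ (r ⬝ᵥ g.toAdd)
      _ = ∑ h, algebraMap K L ((MonoidAlgebra.mapDomain (rowHom ![0, 1] ∘ α) a).coeff h) *
            ψ (d * h.toAdd) :=
          sum_algebraMap_coeff_mul_comp (rowHom ![0, 1] ∘ α) a fun h => ψ (d * h.toAdd)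
      _ = 0 := by simp [ha (-1) _ (spinalPhi_neg_one n) α hα]
  have hcoeff := eq_zero_of_sum_mul_addChar_dotProduct_eq_zero hψ hnL
    (f := fun v => algebraMap K L (a.coeff (.ofAdd v))) hfourier
  ext g
  exact (map_eq_zero (algebraMap K L)).mp (congrFun hcoeff g.toAdd)

theorem isSimpleRing_spinalGroup_iff (K : Type*) [Field K] (p : ℕ) [CharP K p] :
    IsSimpleRing (NekrashevychAlgebra K (spinalGroup n) (ZMod n)) ↔ ¬ p ∣ n := by
  rw [← CharP.cast_eq_zero_iff K p n]
  exact ⟨fun h hn => not_isSimpleRing_spinalGroup n K hn h,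
    fun hn => isSimpleRing_of_isSeparating (isSeparating_spinalData n K hn)⟩

theorem isSelfReplicating_spinalGroup : IsSelfReplicating (spinalGroup n) (ZMod n) :=
  isSelfReplicating ⟨-1, _, spinalPhi_neg_one n, fun h =>
    ⟨.ofAdd ![0, h.toAdd], Multiplicative.toAdd.injective (by simp [rowHom_apply])⟩⟩

end SpinalGroups

section Dihedral

/-- The multispinal data of the infinite dihedral group acting on the words over `ℤ/2`. -/
def dihedralData :
    MultispinalData (ZMod 2) (Multiplicative (ZMod 2)) (Multiplicative (ZMod 2)) where
  Φ k := if k = 0 then .inl 1 else .inr (MonoidHom.id _)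
  free h x hx := by
    have : h.toAdd + x = x := hx
    exact Multiplicative.toAdd.injective (by simpa using this)
  s1 := ⟨0, 1, if_pos rfl⟩
  s2 := ⟨1, MonoidHom.id _, if_neg one_ne_zero⟩
  s3 _ hg := hg 1 (MonoidHom.id _) (if_neg one_ne_zero) 1 (one_mem _)

theorem dihedralData_phi_one : dihedralData.Φ 1 = .inr (MonoidHom.id _) := rfl

theorem isSimpleRing_dihedralGroup (K : Type*) [Field K] :
    IsSimpleRing (NekrashevychAlgebra K dihedralData.group (ZMod 2)) :=
  MultispinalData.isSimpleRing_of_isSeparating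
    (MultispinalData.isSeparating_of_injective dihedralData_phi_one Function.injective_id)

theorem isSelfReplicating_dihedralGroup : IsSelfReplicating dihedralData.group (ZMod 2) :=
  MultispinalData.isSelfReplicating ⟨1, _, dihedralData_phi_one, Function.surjective_id⟩

end Dihedral

theorem two_lt_prod_primes_sq {P : Finset ℕ} (hP : ∀ p ∈ P, p.Prime) (hne : P.Nonempty) :
    2 < (∏ q ∈ P, q) ^ 2 := by
  obtain ⟨q, hq⟩ := hne
  have hle : q ≤ ∏ q ∈ P, q :=
    Nat.le_of_dvd (Finset.prod_pos fun p hp => (hP p hp).pos) (Finset.dvd_prod_of_mem _ hq)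
  nlinarith [(hP q hq).two_le]

theorem dvd_prod_primes_sq_iff {p : ℕ} (hp : p.Prime ∨ p = 0) {P : Finset ℕ}
    (hP : ∀ q ∈ P, q.Prime) : p ∣ (∏ q ∈ P, q) ^ 2 ↔ p ∈ P := by
  refine ⟨fun h => ?_, fun h => (Finset.dvd_prod_of_mem _ h).trans (dvd_pow_self _ two_ne_zero)⟩
  obtain hp | rfl := hp
  · obtain ⟨q, hq, hpq⟩ := (hp.prime.dvd_finsetProd_iff _).mp (hp.dvd_of_dvd_pow h)
    rwa [(Nat.prime_dvd_prime_iff_eq hp (hP q hq)).mp hpq]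
  · exact absurd (zero_dvd_iff.mp h)
      (pow_ne_zero 2 (Finset.prod_ne_zero_iff.mpr fun q hq => (hP q hq).ne_zero))

theorem mainTheorem9 :
    (∀ (n : ℕ) [Fact (2 < n)] (K : Type u) [Field K] (p : ℕ) [CharP K p],
      IsSimpleRing (NekrashevychAlgebra K (spinalGroup n) (ZMod n)) ↔ ¬ p ∣ n) ∧
    (∀ P : Finset ℕ, (∀ p ∈ P, p.Prime) →
      ∃ (X : Type) (_ : Fintype X) (_ : Nontrivial X) (G : Type) (_ : Group G)
        (_ : MulAction G (List X)) (_ : IsSelfSimilar G X),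
        IsContracting G X ∧ IsSelfReplicating G X ∧
        ∀ (K : Type u) [Field K] (p : ℕ) [CharP K p],
          IsSimpleRing (NekrashevychAlgebra K G X) ↔ p ∉ P) := by
  refine ⟨fun n _ K _ p _ => isSimpleRing_spinalGroup_iff n K p, fun P hP => ?_⟩
  obtain rfl | hne := P.eq_empty_or_nonempty
  · exact ⟨ZMod 2, inferInstance, inferInstance, dihedralData.group, inferInstance, inferInstance,
      inferInstance, dihedralData.isContracting, isSelfReplicating_dihedralGroup, fun K _ p _ =>
        iff_of_true (isSimpleRing_dihedralGroup K) (Finset.notMem_empty p)⟩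
  · let n := (∏ q ∈ P, q) ^ 2
    have : Fact (2 < n) := ⟨two_lt_prod_primes_sq hP hne⟩
    have : Fact (1 < n) := ⟨one_lt_two.trans Fact.out⟩
    refine ⟨ZMod n, inferInstance, inferInstance, spinalGroup n, inferInstance, inferInstance,
      inferInstance, (spinalData n).isContracting, isSelfReplicating_spinalGroup n,
      fun K _ p _ => ?_⟩
    rw [isSimpleRing_spinalGroup_iff, dvd_prod_primes_sq_iff (CharP.char_is_prime_or_zero K p) hP]
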